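/- Let $\mathbb G_1$ be the directed graph with vertex set $\mathbb Z^2$ in which every vertex $(a,b)$ has exactly three outgoing edges: to $(a,b+1)$, to $(a,b-1)$, and to $(a+1,b)$ if $b\ge 0$, respectively to $(a-1,b)$ if $b<0$. Let $(M_i)_{i\ge 0}$ be simple random walk on $\mathbb G_1$ started at the origin (each step is uniform over the three outgoing edges of the current vertex). Let $T_0=0$ and, for $k\ge 1$, let $T_k$ be the time just after the $k$-th vertical step of $M$, and write $M_{T_k}=(\Xi_k,S_k)$. The walk performs a half winding around the origin, started at time $T_k$ and completed at time $T_l$, if $S_k=0$, $\Xi_k\neq 0$, $l$ is the first index after $k$ with $S_l=0$, and $\operatorname{sgn}(\Xi_l)=-\operatorname{sgn}(\Xi_k)$. Let $\mathcal N_{\mathbb G_1}(n)$ be the number of windings around the origin completed up to step $n$, two half windings making one winding; that is, $\mathcal N_{\mathbb G_1}(n)=\lfloor H(n)/2\rfloor$, where $H(n)$ is the number of half windings completed at a time at most $n$. Then $$\mathbb E\big(\mathcal N_{\mathbb G_1}(n)\big)\sim \frac{1}{2\pi}\log n\qquad (n\to\infty).$$ -/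

import Mathlib

open MeasureTheory Filter Asymptotics
open scoped ENNReal

/-- The directed graph `𝔾₁` on `ℤ²`: vertical edges in both directions everywhere, horizontal
edges to the right on the closed upper half plane and to the left on the open lower one. -/
def graphG1 : Digraph (ℤ × ℤ) where
  Adj v w := w = (v.1, v.2 + 1) ∨ w = (v.1, v.2 - 1) ∨
    (w = (v.1 + 1, v.2) ∧ 0 ≤ v.2) ∨ (w = (v.1 - 1, v.2) ∧ v.2 < 0)

open Classical in
/-- One-step transition probability of simple random walk on a directed graph: uniform over the
outgoing edges. -/
noncomputable def srwProb {V : Type*} (G : Digraph V) (v w : V) : ℝ≥0∞ :=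
  if G.Adj v w then (({u | G.Adj v u}.encard : ℕ∞) : ℝ≥0∞)⁻¹ else 0

/-- The process `M` on the probability space `(Ω, μ)` is a simple random walk on `G` started at
`o`: it starts at `o` almost surely, and given that it has followed a path `γ` for the first `n`
steps, it next jumps to `w` with probability `srwProb G (γ n) w`. -/
structure IsSimpleRandomWalk {V Ω : Type*} [MeasurableSpace V] [MeasurableSpace Ω]
    (G : Digraph V) (o : V) (μ : Measure Ω) (M : ℕ → Ω → V) : Prop where
  measurable : ∀ n, Measurable (M n)
  start : ∀ᵐ ω ∂μ, M 0 ω = o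
  step : ∀ (n : ℕ) (γ : ℕ → V) (w : V),
    μ {ω | (∀ i ≤ n, M i ω = γ i) ∧ M (n + 1) ω = w} =
      μ {ω | ∀ i ≤ n, M i ω = γ i} * srwProb G (γ n) w

/-- `t` is one of the times `T₀ = 0 < T₁ < T₂ < ⋯`, where `T_k` is the time just after the `k`-th
vertical step of the trajectory `x`. -/
def IsVerticalTime (x : ℕ → ℤ × ℤ) (t : ℕ) : Prop :=
  t = 0 ∨ ∃ s, t = s + 1 ∧ (x t).2 ≠ (x s).2

/-- The trajectory `x`, observed along the times `T_k`, hits the horizontal axis at time `t`. -/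
def HitsAxis (x : ℕ → ℤ × ℤ) (t : ℕ) : Prop :=
  IsVerticalTime x t ∧ (x t).2 = 0

/-- The trajectory `x` performs a half winding around the origin, started at time `s` and completed
at time `t`: these are successive times at which `x` hits the axis, at points `(m, 0)` and
`(m', 0)` with `m ≠ 0` and `sgn m' = - sgn m`. -/
def IsHalfWinding (x : ℕ → ℤ × ℤ) (s t : ℕ) : Prop :=
  s < t ∧ HitsAxis x s ∧ HitsAxis x t ∧ (∀ r, s < r → r < t → ¬ HitsAxis x r) ∧
    (x s).1 ≠ 0 ∧ (x t).1.sign = -(x s).1.sign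

/-- Number of half windings completed by the trajectory `x` up to step `n`. -/
noncomputable def halfWindings (x : ℕ → ℤ × ℤ) (n : ℕ) : ℕ :=
  {t | t ≤ n ∧ ∃ s, IsHalfWinding x s t}.ncard

/-- Number of windings completed by the trajectory `x` up to step `n`; two half windings make one
winding (the division rounds down). -/
noncomputable def windings (x : ℕ → ℤ × ℤ) (n : ℕ) : ℕ :=
  halfWindings x n / 2

/-! The hits of the axis form a renewal scheme. After a hit at `m` the walk drifts right along the
axis to some `e ≥ m`, leaves it vertically, and returns at `e + k` from above or at `e - k` from
below, with the same law of `k ≥ 0` in both cases. If `m` and `e` lie strictly on the same side of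
0, only one of the two kinds of excursion can complete a half winding, and it does so exactly when
`k > |e|`. Hence the discounted number of half windings, the sum of `r ^ t` times the probability
that one is completed at time `t`, equals `crossingGreen` up to a multiple of `originGreen`
(`genFun_halfWindingProb_le`, `crossingGreen_le`). The latter stays bounded as `r → 1`, because the
Green function of the hits is bounded uniformly in the site (`toReal_hitGreen_le`,
`originGreen_le`).

The crossing term is computed by Fourier analysis. Let `l` be the characteristic function at `θ` of
the discounted return law. A first-step analysis in the height gives `l + 1/l = 3/r - exp(iθ)` with
`|l| < 1` (`fourierSum_returnLaw`), and the renewal equations give the transform `l / (1 - |l|²)`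
for the departures from the axis (`fourierSum_green`). The sums over `|e| < k` bring in Dirichlet
kernels, and `crossingGreen` becomes `1/(2π)` times an integral whose main term is `Re l (1 + cos θ)
/ (|l|⁻¹ - |l|)²` (`IsSmallRoot.integrand_eq`). The denominator solves a real quadratic equation and
behaves near 0 like `2|θ|` plus a quantity of order `1 - r`. So the integrand lies between functions
`1/(|θ| + c(1 - r))`, with `c = 24` and `c = 3`, up to an error `O(1 + |θ|^(-1/2))` uniform in `r`,
and the integral is `2 log(1/(1-r)) + O(1)`.

Thus the generating function of the half windings is `π⁻¹ log(1/(1-r)) + O(1)`. Since the logarithm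
varies slowly, an elementary Tauberian argument (`tendsto_sum_div_log_of_abel`) gives `E H(n) ~ π⁻¹
log n`. Two half windings make one winding, and the rounding costs at most `1/2`. -/

/-! ### Events determined by finitely many steps -/

section PrefixEvents

variable {V Ω : Type*} [MeasurableSpace Ω]

/-- The measure of a set is the sum of the measures of its fibres under a countable-valued map. -/
theorem measure_eq_tsum_fiber {β : Type*} [Countable β] [MeasurableSpace β]
    [MeasurableSingletonClass β] (μ : Measure Ω) {f : Ω → β} (hf : Measurable f) (S : Set Ω) :
    μ S = ∑' b, μ {ω | ω ∈ S ∧ f ω = b} := by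
  have h := tsum_measure_preimage_singleton (μ := μ.restrict S) (f := f) (Set.countable_univ)
    (fun y _ => hf (measurableSet_singleton y))
  rw [Set.preimage_univ, Measure.restrict_apply_univ] at h
  rw [← h]
  rw [tsum_univ (fun b => (μ.restrict S) (f ⁻¹' {b}))]
  refine tsum_congr fun b => ?_
  rw [Measure.restrict_apply (hf (measurableSet_singleton b))]
  congr 1
  ext ω
  simp [and_comm]

/-- A property of trajectories that depends only on the first `n` steps. -/
def DependsOnPrefix (n : ℕ) (P : (ℕ → V) → Prop) : Prop :=
  ∀ x x' : ℕ → V, (∀ i ≤ n, x i = x' i) → (P x ↔ P x')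

theorem DependsOnPrefix.mono {n m : ℕ} (h : n ≤ m) {P : (ℕ → V) → Prop}
    (hP : DependsOnPrefix n P) : DependsOnPrefix m P :=
  fun x x' hx => hP x x' fun i hi => hx i (hi.trans h)

theorem DependsOnPrefix.and {n : ℕ} {P Q : (ℕ → V) → Prop}
    (hP : DependsOnPrefix n P) (hQ : DependsOnPrefix n Q) :
    DependsOnPrefix n fun x => P x ∧ Q x :=
  fun x x' hx => and_congr (hP x x' hx) (hQ x x' hx)

theorem dependsOnPrefix_apply {n i : ℕ} (hi : i ≤ n) (p : V → Prop) :
    DependsOnPrefix n fun x => p (x i) :=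
  fun x x' hx => by simp only [hx i hi]

variable [Countable V] [MeasurableSpace V] [MeasurableSingletonClass V]

theorem DependsOnPrefix.measurableSet {n : ℕ} {P : (ℕ → V) → Prop} (hP : DependsOnPrefix n P)
    {M : ℕ → Ω → V} (hM : ∀ i, Measurable (M i)) :
    MeasurableSet {ω | P fun i => M i ω} := by
  let Y : Ω → Fin (n + 1) → V := fun ω i => M i ω
  have hY : Measurable Y := measurable_pi_lambda _ fun i => hM i
  have : {ω | P fun i => M i ω} = Y ⁻¹' {γ | P fun i => γ (Fin.ofNat (n + 1) i)} := by
    ext ω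
    refine hP _ _ fun i hi => ?_
    simp [Y, Nat.mod_eq_of_lt (Nat.lt_succ_of_le hi)]
  rw [this]
  exact hY (Set.to_countable _).measurableSet

/-- The defining property speaks of one path at a time; an event about the first `n` steps is a
countable disjoint union of such path events, so the Markov property follows by summation. -/
theorem IsSimpleRandomWalk.measure_prefix_step {G : Digraph V} {o : V} {μ : Measure Ω}
    {M : ℕ → Ω → V} (h : IsSimpleRandomWalk G o μ M) {n : ℕ} {P : (ℕ → V) → Prop}
    (hP : DependsOnPrefix n P) (v w : V) :
    μ {ω | (P (fun i => M i ω) ∧ M n ω = v) ∧ M (n + 1) ω = w} =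
      μ {ω | P (fun i => M i ω) ∧ M n ω = v} * srwProb G v w := by
  let Y : Ω → Fin (n + 1) → V := fun ω i => M i ω
  have hY : Measurable Y := measurable_pi_lambda _ fun i => h.measurable i
  rw [measure_eq_tsum_fiber μ hY, measure_eq_tsum_fiber μ hY {ω | P (fun i => M i ω) ∧ M n ω = v},
    ← ENNReal.tsum_mul_right]
  refine tsum_congr fun γ => ?_
  let γ' : ℕ → V := fun i => γ (Fin.ofNat (n + 1) i)
  have hYγ : ∀ ω, Y ω = γ ↔ ∀ i ≤ n, M i ω = γ' i := by
    intro ω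
    constructor
    · rintro rfl i hi
      simp [Y, γ', Nat.mod_eq_of_lt (Nat.lt_succ_of_le hi)]
    · intro hi
      funext i
      simpa [γ', Y] using hi i (Nat.lt_succ_iff.mp i.2)
  by_cases hv : P γ' ∧ γ' n = v
  · have h1 : {ω | ω ∈ {ω | (P (fun i => M i ω) ∧ M n ω = v) ∧ M (n + 1) ω = w} ∧ Y ω = γ} =
        {ω | (∀ i ≤ n, M i ω = γ' i) ∧ M (n + 1) ω = w} := by
      ext ω
      simp only [Set.mem_ofPred_eq, hYγ]
      constructor
      · rintro ⟨⟨-, h1⟩, h2⟩; exact ⟨h2, h1⟩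
      · rintro ⟨h2, h1⟩
        exact ⟨⟨⟨(hP _ _ h2).2 hv.1, (h2 n le_rfl).trans hv.2⟩, h1⟩, h2⟩
    have h2 : {ω | ω ∈ {ω | P (fun i => M i ω) ∧ M n ω = v} ∧ Y ω = γ} =
        {ω | ∀ i ≤ n, M i ω = γ' i} := by
      ext ω
      simp only [Set.mem_ofPred_eq, hYγ]
      constructor
      · rintro ⟨-, h2⟩; exact h2
      · intro h2
        exact ⟨⟨(hP _ _ h2).2 hv.1, (h2 n le_rfl).trans hv.2⟩, h2⟩
    rw [h1, h2, h.step, hv.2]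
  · have hne : ∀ ω, Y ω = γ → ¬ (P (fun i => M i ω) ∧ M n ω = v) := by
      intro ω hω hc
      rw [hYγ] at hω
      exact hv ⟨(hP _ _ hω).1 hc.1, (hω n le_rfl).symm.trans hc.2⟩
    have h1 : {ω | ω ∈ {ω | (P (fun i => M i ω) ∧ M n ω = v) ∧ M (n + 1) ω = w} ∧ Y ω = γ} = ∅ := by
      ext ω
      simp only [Set.mem_ofPred_eq, Set.mem_empty_iff_false, iff_false]
      rintro ⟨⟨h1, -⟩, h2⟩; exact hne ω h2 h1
    have h2 : {ω | ω ∈ {ω | P (fun i => M i ω) ∧ M n ω = v} ∧ Y ω = γ} = ∅ := by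
      ext ω
      simp only [Set.mem_ofPred_eq, Set.mem_empty_iff_false, iff_false]
      rintro ⟨h1, h2⟩; exact hne ω h2 h1
    rw [h1, h2]; simp

end PrefixEvents

/-! ### The graph and its three-term one-step equation -/

/-- The horizontal displacement of a horizontal edge of `graphG1` at height `y`. -/
def horizontalStep (y : ℤ) : ℤ := if 0 ≤ y then 1 else -1

theorem graphG1_adj_iff (v w : ℤ × ℤ) : graphG1.Adj v w ↔
    w = (v.1, v.2 + 1) ∨ w = (v.1, v.2 - 1) ∨ w = (v.1 + horizontalStep v.2, v.2) := by
  unfold graphG1 horizontalStep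
  by_cases h : 0 ≤ v.2
  · simp [h, not_lt.2 h]
  · simp [h, not_le.1 h, sub_eq_add_neg]

theorem encard_graphG1_adj (v : ℤ × ℤ) : {u | graphG1.Adj v u}.encard = 3 := by
  have : {u | graphG1.Adj v u} =
      ({(v.1, v.2 + 1), (v.1, v.2 - 1), (v.1 + horizontalStep v.2, v.2)} : Set (ℤ × ℤ)) := by
    ext u
    simp [graphG1_adj_iff]
  rw [this, Set.encard_insert_of_notMem, Set.encard_pair]
  · norm_num
  · simp
  · simp only [Set.mem_insert_iff, Prod.mk.injEq, Set.mem_singleton_iff, not_or, not_and]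
    constructor <;> intros <;> omega

theorem srwProb_graphG1 (v w : ℤ × ℤ) [Decidable (graphG1.Adj v w)] :
    srwProb graphG1 v w = if graphG1.Adj v w then 3⁻¹ else 0 := by
  unfold srwProb
  rw [encard_graphG1_adj]
  by_cases h : graphG1.Adj v w <;> simp [h]

/-- The direction of a horizontal edge depends only on the height, which the edge preserves. Edges
can therefore be reversed explicitly, and every vertex has exactly three predecessors as well as
three successors. -/
theorem horizontalStep_predecessor (v : ℤ × ℤ) (x y : ℤ) :
    graphG1.Adj v (x, y) ↔ v = (x, y + 1) ∨ v = (x, y - 1) ∨ v = (x - horizontalStep y, y) := by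
  obtain ⟨a, b⟩ := v
  simp only [graphG1_adj_iff, Prod.mk.injEq]
  constructor
  · rintro (⟨h1, h2⟩ | ⟨h1, h2⟩ | ⟨h1, h2⟩)
    · right; left; omega
    · left; omega
    · right; right; subst h2; omega
  · rintro (⟨h1, h2⟩ | ⟨h1, h2⟩ | ⟨h1, h2⟩)
    · right; left; omega
    · left; omega
    · right; right; subst h2; omega

section Walk

variable {Ω : Type*} [MeasurableSpace Ω] {μ : Measure Ω} {M : ℕ → Ω → ℤ × ℤ}

/-- Every vertex of `graphG1` has three predecessors, so the one-step equation of the walk is a sum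
of three terms. -/
theorem IsSimpleRandomWalk.measure_prefix_next (h : IsSimpleRandomWalk graphG1 (0, 0) μ M)
    {n : ℕ} {P : (ℕ → ℤ × ℤ) → Prop} (hP : DependsOnPrefix n P) (x y : ℤ) :
    μ {ω | P (fun i => M i ω) ∧ M (n + 1) ω = (x, y)} =
      3⁻¹ * (μ {ω | P (fun i => M i ω) ∧ M n ω = (x, y + 1)} +
        μ {ω | P (fun i => M i ω) ∧ M n ω = (x, y - 1)} +
        μ {ω | P (fun i => M i ω) ∧ M n ω = (x - horizontalStep y, y)}) := by
  classical
  rw [measure_eq_tsum_fiber μ (h.measurable n)]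
  have : ∀ v, μ {ω | ω ∈ {ω | P (fun i => M i ω) ∧ M (n + 1) ω = (x, y)} ∧ M n ω = v} =
      μ {ω | P (fun i => M i ω) ∧ M n ω = v} * srwProb graphG1 v (x, y) := by
    intro v
    rw [← h.measure_prefix_step hP]
    congr 1
    ext ω
    simp only [Set.mem_ofPred_eq]
    tauto
  simp_rw [this, srwProb_graphG1, horizontalStep_predecessor]
  have hne1 : ((x, y + 1) : ℤ × ℤ) ≠ (x, y - 1) := by
    simp only [ne_eq, Prod.mk.injEq, not_and]; omega
  have hne2 : ((x, y + 1) : ℤ × ℤ) ≠ (x - horizontalStep y, y) := by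
    simp only [ne_eq, Prod.mk.injEq, not_and]; omega
  have hne3 : ((x, y - 1) : ℤ × ℤ) ≠ (x - horizontalStep y, y) := by
    simp only [ne_eq, Prod.mk.injEq, not_and]; omega
  rw [tsum_eq_sum (s := {(x, y + 1), (x, y - 1), (x - horizontalStep y, y)})]
  · rw [Finset.sum_insert (by simp [hne1, hne2]), Finset.sum_pair hne3]
    simp
    ring
  · intro v hv
    simp only [Finset.mem_insert, Finset.mem_singleton] at hv
    simp [hv]

end Walk

/-! ### Hits of the axis and the last-hit decomposition -/

/-- At the last time up to `t` when the trajectory `x` hits the axis, its abscissa is `m`. -/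
def LastHitAt (x : ℕ → ℤ × ℤ) (t : ℕ) (m : ℤ) : Prop :=
  ∃ s ≤ t, HitsAxis x s ∧ (x s).1 = m ∧ ∀ i, s < i → i ≤ t → ¬ HitsAxis x i

/-- The points with abscissas `m` and `m'` lie on opposite sides of the origin. -/
def OppositeSides (m m' : ℤ) : Prop := m ≠ 0 ∧ m'.sign = -m.sign

theorem hitsAxis_zero_iff (x : ℕ → ℤ × ℤ) : HitsAxis x 0 ↔ (x 0).2 = 0 := by
  simp [HitsAxis, IsVerticalTime]

/-- Moving along the axis is not a hit: a hit after time 0 is an arrival by a vertical step. -/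
theorem hitsAxis_succ_iff (x : ℕ → ℤ × ℤ) (t : ℕ) :
    HitsAxis x (t + 1) ↔ (x (t + 1)).2 = 0 ∧ (x t).2 ≠ 0 := by
  simp only [HitsAxis, IsVerticalTime, Nat.add_eq_zero_iff, one_ne_zero, and_false, false_or,
    Nat.add_right_cancel_iff]
  constructor
  · rintro ⟨⟨s, rfl, hs⟩, h0⟩
    exact ⟨h0, by rw [h0] at hs; exact hs.symm⟩
  · rintro ⟨h0, hs⟩
    exact ⟨⟨t, rfl, by rw [h0]; exact hs.symm⟩, h0⟩

theorem dependsOnPrefix_hitsAxis {n t : ℕ} (h : t ≤ n) :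
    DependsOnPrefix n fun x => HitsAxis x t := by
  intro x x' hx
  cases t with
  | zero => simp only [hitsAxis_zero_iff, hx 0 h]
  | succ t => simp only [hitsAxis_succ_iff, hx _ h, hx t ((Nat.le_succ t).trans h)]

theorem dependsOnPrefix_lastHitAt (t : ℕ) (m : ℤ) :
    DependsOnPrefix t fun x => LastHitAt x t m := by
  intro x x' hx
  have key : ∀ x x' : ℕ → ℤ × ℤ, (∀ i ≤ t, x i = x' i) → LastHitAt x t m → LastHitAt x' t m := by
    rintro x x' hx ⟨s, hs, h1, h2, h3⟩
    exact ⟨s, hs, (dependsOnPrefix_hitsAxis hs x x' hx).1 h1, hx s hs ▸ h2, fun i hi hit hc =>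
      h3 i hi hit ((dependsOnPrefix_hitsAxis hit x x' hx).2 hc)⟩
  exact ⟨key x x' hx, key x' x fun i hi => (hx i hi).symm⟩

theorem lastHitAt_zero_iff (x : ℕ → ℤ × ℤ) (m : ℤ) : LastHitAt x 0 m ↔ x 0 = (m, 0) := by
  constructor
  · rintro ⟨s, hs, h1, h2, -⟩
    obtain rfl := Nat.le_zero.1 hs
    rw [hitsAxis_zero_iff] at h1
    exact Prod.ext h2 h1
  · intro h
    refine ⟨0, le_rfl, ?_, ?_, fun i hi hi' => absurd (hi.trans_le hi') (lt_irrefl _)⟩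
    · rw [hitsAxis_zero_iff, h]
    · rw [h]

theorem lastHitAt_succ_iff (x : ℕ → ℤ × ℤ) (t : ℕ) (m : ℤ) : LastHitAt x (t + 1) m ↔
    (HitsAxis x (t + 1) ∧ (x (t + 1)).1 = m) ∨ (¬ HitsAxis x (t + 1) ∧ LastHitAt x t m) := by
  constructor
  · rintro ⟨s, hs, h1, h2, h3⟩
    rcases Nat.lt_or_ge s (t + 1) with h | h
    · exact Or.inr ⟨h3 _ h le_rfl, s, Nat.lt_succ_iff.1 h, h1, h2, fun i hi hit =>
        h3 i hi (hit.trans (Nat.le_succ t))⟩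
    · obtain rfl := le_antisymm hs h
      exact Or.inl ⟨h1, h2⟩
  · rintro (⟨h1, h2⟩ | ⟨h0, s, hs, h1, h2, h3⟩)
    · exact ⟨t + 1, le_rfl, h1, h2, fun i hi hi' => absurd (hi.trans_le hi') (lt_irrefl _)⟩
    · refine ⟨s, hs.trans (Nat.le_succ t), h1, h2, fun i hi hit => ?_⟩
      rcases Nat.lt_or_ge i (t + 1) with h | h
      · exact h3 i hi (Nat.lt_succ_iff.1 h)
      · rwa [le_antisymm hit h]

theorem LastHitAt.unique {x : ℕ → ℤ × ℤ} {t : ℕ} {m m' : ℤ} (h : LastHitAt x t m)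
    (h' : LastHitAt x t m') : m = m' := by
  obtain ⟨s, hs, h1, h2, h3⟩ := h
  obtain ⟨s', hs', h1', h2', h3'⟩ := h'
  rcases lt_trichotomy s s' with hlt | rfl | hlt
  · exact absurd h1' (h3 s' hlt hs')
  · rw [← h2, ← h2']
  · exact absurd h1 (h3' s hlt hs)

theorem exists_lastHitAt {x : ℕ → ℤ × ℤ} (h0 : x 0 = (0, 0)) (t : ℕ) : ∃ m, LastHitAt x t m := by
  induction t with
  | zero => exact ⟨0, (lastHitAt_zero_iff x 0).2 h0⟩
  | succ t ih =>
    obtain ⟨m, hm⟩ := ih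
    by_cases h : HitsAxis x (t + 1)
    · exact ⟨_, (lastHitAt_succ_iff _ _ _).2 (Or.inl ⟨h, rfl⟩)⟩
    · exact ⟨m, (lastHitAt_succ_iff _ _ _).2 (Or.inr ⟨h, hm⟩)⟩

/-- The starting time of the half winding is forgotten: only the abscissa of the last hit matters,
which makes the event accessible to one-step equations. -/
theorem exists_isHalfWinding_succ_iff (x : ℕ → ℤ × ℤ) (t : ℕ) :
    (∃ s, IsHalfWinding x s (t + 1)) ↔
      ∃ m, LastHitAt x t m ∧ HitsAxis x (t + 1) ∧ OppositeSides m (x (t + 1)).1 := by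
  constructor
  · rintro ⟨s, hs, h1, h2, h3, h4, h5⟩
    exact ⟨(x s).1, ⟨s, Nat.lt_succ_iff.1 hs, h1, rfl, fun i hi hit =>
      h3 i hi (Nat.lt_succ_of_le hit)⟩, h2, h4, h5⟩
  · rintro ⟨m, ⟨s, hs, h1, rfl, h3⟩, h2, h4, h5⟩
    exact ⟨s, Nat.lt_succ_of_le hs, h1, h2, fun i hi hit => h3 i hi (Nat.lt_succ_iff.1 hit), h4, h5⟩

theorem not_isHalfWinding_zero (x : ℕ → ℤ × ℤ) (s : ℕ) : ¬ IsHalfWinding x s 0 :=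
  fun h => absurd h.1 (Nat.not_lt_zero s)

theorem dependsOnPrefix_exists_isHalfWinding (t : ℕ) :
    DependsOnPrefix t fun x => ∃ s, IsHalfWinding x s t := by
  intro x x' hx
  cases t with
  | zero => simp [not_isHalfWinding_zero]
  | succ t =>
    simp only [exists_isHalfWinding_succ_iff]
    refine exists_congr fun m => and_congr ?_ (and_congr ?_ ?_)
    · exact dependsOnPrefix_lastHitAt t m x x' fun i hi => hx i (hi.trans (Nat.le_succ t))
    · exact dependsOnPrefix_hitsAxis le_rfl x x' hx
    · rw [hx _ le_rfl]

/-! ### One-step equations for the hitting probabilities -/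

section Probabilities

variable {Ω : Type*} [MeasurableSpace Ω]

/-- Probability that the walk is at `(x, y)` at time `t`, its last hit of the axis being at
abscissa `m`. -/
noncomputable def lastHitProb (μ : Measure Ω) (M : ℕ → Ω → ℤ × ℤ) (t : ℕ) (m x y : ℤ) : ℝ≥0∞ :=
  μ {ω | LastHitAt (fun i => M i ω) t m ∧ M t ω = (x, y)}

/-- Probability that the walk hits the axis at time `t` in `(m, 0)`. -/
noncomputable def hitProb (μ : Measure Ω) (M : ℕ → Ω → ℤ × ℤ) (t : ℕ) (m : ℤ) : ℝ≥0∞ :=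
  μ {ω | HitsAxis (fun i => M i ω) t ∧ M t ω = (m, 0)}

/-- Probability that a half winding is completed at time `t`. -/
noncomputable def halfWindingProb (μ : Measure Ω) (M : ℕ → Ω → ℤ × ℤ) (t : ℕ) : ℝ≥0∞ :=
  μ {ω | ∃ s, IsHalfWinding (fun i => M i ω) s t}

variable {μ : Measure Ω} {M : ℕ → Ω → ℤ × ℤ}

theorem IsSimpleRandomWalk.measure_start [IsProbabilityMeasure μ]
    (h : IsSimpleRandomWalk graphG1 (0, 0) μ M) (v : ℤ × ℤ) :
    μ {ω | M 0 ω = v} = if v = (0, 0) then 1 else 0 := by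
  split_ifs with hv
  · subst hv
    have := h.start
    exact (prob_compl_eq_zero_iff (h.measurable 0 (measurableSet_singleton (0, 0)))).1 this
  · refine measure_mono_null ?_ h.start
    intro ω hω
    have : M 0 ω = v := hω
    change ¬ (M 0 ω = (0, 0))
    rw [this]; exact hv

theorem lastHitProb_zero (m x y : ℤ) :
    lastHitProb μ M 0 m x y = if y = 0 ∧ x = m then hitProb μ M 0 m else 0 := by
  unfold lastHitProb hitProb
  simp only [lastHitAt_zero_iff, hitsAxis_zero_iff]
  split_ifs with hxy
  · obtain ⟨rfl, rfl⟩ := hxy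
    congr 1
    ext ω
    simp only [Set.mem_ofPred_eq]
    constructor
    · rintro ⟨h1, -⟩; exact ⟨by rw [h1], h1⟩
    · rintro ⟨-, h1⟩; exact ⟨h1, h1⟩
  · convert measure_empty (μ := μ)
    ext ω
    simp only [Set.mem_ofPred_eq, Set.mem_empty_iff_false, iff_false]
    rintro ⟨h1, h2⟩
    rw [h1, Prod.mk.injEq] at h2
    exact hxy ⟨h2.2.symm, h2.1.symm⟩

theorem hitProb_zero [IsProbabilityMeasure μ] (h : IsSimpleRandomWalk graphG1 (0, 0) μ M)
    (m : ℤ) : hitProb μ M 0 m = if m = 0 then 1 else 0 := by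
  have : {ω | HitsAxis (fun i => M i ω) 0 ∧ M 0 ω = (m, 0)} = {ω | M 0 ω = (m, 0)} := by
    ext ω
    simp only [Set.mem_ofPred_eq, hitsAxis_zero_iff, and_iff_right_iff_imp]
    intro h1; rw [h1]
  rw [hitProb, this, h.measure_start]
  simp

theorem lastHitProb_succ_of_ne (h : IsSimpleRandomWalk graphG1 (0, 0) μ M)
    (t : ℕ) (m x : ℤ) {y : ℤ} (hy : y ≠ 0) : lastHitProb μ M (t + 1) m x y =
      3⁻¹ * (lastHitProb μ M t m x (y + 1) + lastHitProb μ M t m x (y - 1) +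
        lastHitProb μ M t m (x - horizontalStep y) y) := by
  unfold lastHitProb
  rw [← h.measure_prefix_next (dependsOnPrefix_lastHitAt t m)]
  congr 1
  ext ω
  simp only [Set.mem_ofPred_eq, lastHitAt_succ_iff, hitsAxis_succ_iff]
  refine and_congr_left fun hω => ?_
  simp [hω, hy]

/-- Split according to whether the walk is on the axis at time `t`. If not, its arrival is a new
hit, so its abscissa must be `m`; if so, it came from the left neighbour and the last hit is
unchanged. -/
theorem lastHitProb_succ_zero (h : IsSimpleRandomWalk graphG1 (0, 0) μ M)
    (t : ℕ) (m x : ℤ) : lastHitProb μ M (t + 1) m x 0 =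
      (if x = m then hitProb μ M (t + 1) m else 0) + 3⁻¹ * lastHitProb μ M t m (x - 1) 0 := by
  have hmeas : MeasurableSet {ω | (M t ω).2 = 0} :=
    (dependsOnPrefix_apply le_rfl fun v : ℤ × ℤ => v.2 = 0).measurableSet h.measurable
  have hn := h.measure_prefix_next (n := t) (P := fun x => LastHitAt x t m ∧ (x t).2 = 0)
    ((dependsOnPrefix_lastHitAt t m).and
      (dependsOnPrefix_apply le_rfl fun v : ℤ × ℤ => v.2 = 0)) x 0
  have e1 : ∀ z : ℤ, z ≠ 0 → {ω | (LastHitAt (fun i => M i ω) t m ∧ (M t ω).2 = 0) ∧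
      M t ω = (x, z)} = ∅ := by
    intro z hz
    ext ω; simp only [Set.mem_ofPred_eq, Set.mem_empty_iff_false, iff_false]
    rintro ⟨⟨-, h1⟩, h2⟩; rw [h2] at h1; exact hz h1
  have e2 : {ω | (LastHitAt (fun i => M i ω) t m ∧ (M t ω).2 = 0) ∧
      M t ω = (x - horizontalStep 0, 0)} =
      {ω | LastHitAt (fun i => M i ω) t m ∧ M t ω = (x - 1, 0)} := by
    ext ω; simp only [Set.mem_ofPred_eq, horizontalStep, le_refl, if_true]
    constructor
    · rintro ⟨⟨h1, -⟩, h2⟩; exact ⟨h1, h2⟩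
    · rintro ⟨h1, h2⟩; exact ⟨⟨h1, by rw [h2]⟩, h2⟩
  rw [e1 (0 + 1) (by norm_num), e1 (0 - 1) (by norm_num), e2, measure_empty, add_zero,
    zero_add] at hn
  unfold lastHitProb
  rw [← measure_inter_add_sdiff _ hmeas, ← hn, add_comm]
  congr 1
  · split_ifs with hx
    · rw [hitProb]
      congr 1
      ext ω
      simp only [Set.mem_sdiff, Set.mem_ofPred_eq, lastHitAt_succ_iff, hitsAxis_succ_iff, hx]
      constructor
      · rintro ⟨⟨h1, h2⟩, h3⟩; exact ⟨⟨by rw [h2], h3⟩, h2⟩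
      · rintro ⟨⟨h1, h3⟩, h2⟩; exact ⟨⟨Or.inl ⟨⟨h1, h3⟩, by rw [h2]⟩, h2⟩, h3⟩
    · convert measure_empty (μ := μ)
      ext ω
      simp only [Set.mem_sdiff, Set.mem_ofPred_eq, lastHitAt_succ_iff, hitsAxis_succ_iff,
        Set.mem_empty_iff_false, iff_false]
      rintro ⟨⟨h1 | h1, h2⟩, h3⟩
      · rw [h2] at h1; exact hx h1.2
      · exact h1.1 ⟨by rw [h2], h3⟩
  · congr 1
    ext ω
    simp only [Set.mem_inter_iff, Set.mem_ofPred_eq, lastHitAt_succ_iff, hitsAxis_succ_iff]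
    constructor
    · rintro ⟨⟨h1 | h1, h2⟩, h3⟩
      · exact absurd h3 h1.1.2
      · exact ⟨⟨h1.2, h3⟩, h2⟩
    · rintro ⟨⟨h1, h3⟩, h2⟩
      exact ⟨⟨Or.inr ⟨fun hc => hc.2 h3, h1⟩, h2⟩, h3⟩

theorem measure_lastHitAt_hitsAxis_succ (h : IsSimpleRandomWalk graphG1 (0, 0) μ M)
    (t : ℕ) (m m' : ℤ) :
    μ {ω | LastHitAt (fun i => M i ω) t m ∧ HitsAxis (fun i => M i ω) (t + 1) ∧
      M (t + 1) ω = (m', 0)} =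
      3⁻¹ * (lastHitProb μ M t m m' 1 + lastHitProb μ M t m m' (-1)) := by
  have := h.measure_prefix_next (n := t) (P := fun x => LastHitAt x t m ∧ (x t).2 ≠ 0)
    ((dependsOnPrefix_lastHitAt t m).and
      (dependsOnPrefix_apply le_rfl fun v : ℤ × ℤ => v.2 ≠ 0)) m' 0
  have e1 : ∀ z : ℤ, z ≠ 0 → μ {ω | (LastHitAt (fun i => M i ω) t m ∧ (M t ω).2 ≠ 0) ∧
      M t ω = (m', z)} = lastHitProb μ M t m m' z := by
    intro z hz
    unfold lastHitProb
    congr 1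
    ext ω; simp only [Set.mem_ofPred_eq]
    constructor
    · rintro ⟨⟨h1, -⟩, h2⟩; exact ⟨h1, h2⟩
    · rintro ⟨h1, h2⟩; exact ⟨⟨h1, by rw [h2]; exact hz⟩, h2⟩
  have e3 : {ω | (LastHitAt (fun i => M i ω) t m ∧ (M t ω).2 ≠ 0) ∧
      M t ω = (m' - horizontalStep 0, 0)} = ∅ := by
    ext ω; simp only [Set.mem_ofPred_eq, Set.mem_empty_iff_false, iff_false]
    rintro ⟨⟨-, h1⟩, h2⟩; simp [h2] at h1
  rw [e1 _ (by norm_num), e1 _ (by norm_num), e3, measure_empty, add_zero, zero_add,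
    zero_sub] at this
  rw [← this]
  congr 1
  ext ω
  simp only [Set.mem_ofPred_eq, hitsAxis_succ_iff]
  constructor
  · rintro ⟨h0, ⟨h1, h2⟩, h3⟩; exact ⟨⟨h0, h2⟩, h3⟩
  · rintro ⟨⟨h0, h2⟩, h3⟩; exact ⟨h0, ⟨by rw [h3], h2⟩, h3⟩

theorem hitProb_succ (h : IsSimpleRandomWalk graphG1 (0, 0) μ M) (t : ℕ) (m : ℤ) :
    hitProb μ M (t + 1) m = 3⁻¹ * (μ {ω | M t ω = (m, 1)} + μ {ω | M t ω = (m, -1)}) := by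
  have := h.measure_prefix_next (n := t) (P := fun x => (x t).2 ≠ 0)
    (dependsOnPrefix_apply le_rfl fun v : ℤ × ℤ => v.2 ≠ 0) m 0
  have e1 : {ω | (M t ω).2 ≠ 0 ∧ M t ω = (m, 0 + 1)} = {ω | M t ω = (m, 1)} := by
    ext ω; simp only [Set.mem_ofPred_eq, and_iff_right_iff_imp, zero_add]
    intro h1; simp [h1]
  have e2 : {ω | (M t ω).2 ≠ 0 ∧ M t ω = (m, 0 - 1)} = {ω | M t ω = (m, -1)} := by
    ext ω; simp only [Set.mem_ofPred_eq, and_iff_right_iff_imp, zero_sub]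
    intro h1; simp [h1]
  have e3 : {ω | (M t ω).2 ≠ 0 ∧ M t ω = (m - horizontalStep 0, 0)} = ∅ := by
    ext ω; simp only [Set.mem_ofPred_eq, Set.mem_empty_iff_false, iff_false]
    rintro ⟨h1, h2⟩; simp [h2] at h1
  rw [e1, e2, e3, measure_empty, add_zero] at this
  rw [← this, hitProb]
  congr 1
  ext ω
  simp only [Set.mem_ofPred_eq, hitsAxis_succ_iff]
  constructor
  · rintro ⟨⟨h1, h2⟩, h3⟩; exact ⟨h2, h3⟩
  · rintro ⟨h2, h3⟩; exact ⟨⟨by rw [h3], h2⟩, h3⟩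

/-- The start at the origin counts as a hit, so almost surely a last hit exists at every time, and
it is unique. -/
theorem tsum_lastHitProb (h : IsSimpleRandomWalk graphG1 (0, 0) μ M) (t : ℕ) (x y : ℤ) :
    ∑' m, lastHitProb μ M t m x y = μ {ω | M t ω = (x, y)} := by
  unfold lastHitProb
  rw [← measure_iUnion]
  · refine le_antisymm (measure_mono ?_) (measure_mono_ae ?_)
    · intro ω hω
      obtain ⟨m, hm⟩ := Set.mem_iUnion.1 hω
      exact hm.2
    · filter_upwards [h.start] with ω h0 hω
      obtain ⟨m, hm⟩ := exists_lastHitAt (x := fun i => M i ω) h0 t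
      exact Set.mem_iUnion.2 ⟨m, hm, hω⟩
  · intro m m' hne
    refine Set.disjoint_left.2 fun ω h1 h2 => hne (h1.1.unique h2.1)
  · intro m
    exact ((dependsOnPrefix_lastHitAt t m).and
      (dependsOnPrefix_apply le_rfl fun v => v = (x, y))).measurableSet h.measurable

open Classical in
theorem halfWindingProb_succ (h : IsSimpleRandomWalk graphG1 (0, 0) μ M) (t : ℕ) :
    halfWindingProb μ M (t + 1) = ∑' m, ∑' m', if OppositeSides m m' then
      3⁻¹ * (lastHitProb μ M t m m' 1 + lastHitProb μ M t m m' (-1)) else 0 := by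
  have hset : {ω | ∃ s, IsHalfWinding (fun i => M i ω) s (t + 1)} =
      ⋃ p : ℤ × ℤ, {ω | (LastHitAt (fun i => M i ω) t p.1 ∧ HitsAxis (fun i => M i ω) (t + 1) ∧
        M (t + 1) ω = (p.2, 0)) ∧ OppositeSides p.1 p.2} := by
    ext ω
    simp only [Set.mem_ofPred_eq, exists_isHalfWinding_succ_iff, Set.mem_iUnion, Prod.exists]
    refine exists_congr fun m => ?_
    constructor
    · rintro ⟨h1, h2, h3⟩
      exact ⟨_, ⟨h1, h2, Prod.ext rfl h2.2⟩, h3⟩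
    · rintro ⟨m', ⟨h1, h2, h4⟩, h3⟩
      refine ⟨h1, h2, ?_⟩
      rw [h4]; exact h3
  rw [halfWindingProb, hset, measure_iUnion, ENNReal.tsum_prod']
  · refine tsum_congr fun m => tsum_congr fun m' => ?_
    split_ifs with ho
    · rw [← measure_lastHitAt_hitsAxis_succ h]
      simp [ho]
    · simp [ho]
  · rintro ⟨m, m'⟩ ⟨n, n'⟩ hne
    refine Set.disjoint_left.2 fun ω h1 h2 => hne ?_
    have e1 : m = n := h1.1.1.unique h2.1.1
    have e2 : m' = n' := congrArg Prod.fst (h1.1.2.2.symm.trans h2.1.2.2)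
    rw [e1, e2]
  · rintro ⟨m, m'⟩
    exact ((((dependsOnPrefix_lastHitAt t m).mono (Nat.le_succ t)).and
      ((dependsOnPrefix_hitsAxis le_rfl).and
      (dependsOnPrefix_apply le_rfl fun v : ℤ × ℤ => v = (m', 0)))).and
      (fun _ _ _ => Iff.rfl : DependsOnPrefix (t + 1)
        fun _ : ℕ → ℤ × ℤ => OppositeSides m m')).measurableSet h.measurable

theorem halfWindingProb_zero : halfWindingProb μ M 0 = 0 := by
  simp [halfWindingProb, not_isHalfWinding_zero]

end Probabilities

/-! ### Generating functions in time -/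

/-- Generating function of a sequence. -/
noncomputable def genFun (r : ℝ≥0∞) (f : ℕ → ℝ≥0∞) : ℝ≥0∞ := ∑' t, r ^ t * f t

theorem genFun_succ (r : ℝ≥0∞) (f : ℕ → ℝ≥0∞) :
    genFun r f = f 0 + r * genFun r fun t => f (t + 1) := by
  unfold genFun
  rw [tsum_eq_zero_add' ENNReal.summable, pow_zero, one_mul, ← ENNReal.tsum_mul_left]
  simp_rw [pow_succ', mul_assoc]

theorem genFun_add (r : ℝ≥0∞) (f g : ℕ → ℝ≥0∞) :
    (genFun r fun t => f t + g t) = genFun r f + genFun r g := by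
  unfold genFun
  rw [← ENNReal.tsum_add]
  simp_rw [mul_add]

theorem genFun_const_mul (r a : ℝ≥0∞) (f : ℕ → ℝ≥0∞) :
    (genFun r fun t => a * f t) = a * genFun r f := by
  unfold genFun
  rw [← ENNReal.tsum_mul_left]
  simp_rw [mul_left_comm]

theorem genFun_tsum {ι : Type*} (r : ℝ≥0∞) (f : ι → ℕ → ℝ≥0∞) :
    (genFun r fun t => ∑' i, f i t) = ∑' i, genFun r (f i) := by
  unfold genFun
  rw [ENNReal.tsum_comm]
  simp_rw [ENNReal.tsum_mul_left]

theorem genFun_zero (r : ℝ≥0∞) : (genFun r fun _ => 0) = 0 := by simp [genFun]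

theorem genFun_le (r : ℝ≥0∞) {f : ℕ → ℝ≥0∞} (hf : ∀ t, f t ≤ 1) : genFun r f ≤ (1 - r)⁻¹ := by
  rw [← ENNReal.tsum_geometric]
  exact ENNReal.tsum_le_tsum fun t => mul_le_of_le_one_right' (hf t)

theorem inv_one_sub_ne_top {r : ℝ≥0∞} (hr : r < 1) : (1 - r)⁻¹ ≠ ⊤ :=
  ENNReal.inv_ne_top.2 (tsub_pos_of_lt hr).ne'

/-! ### Green function of the walk between two hits of the axis -/

/-- The linear system satisfied by the Green function of the walk killed when it hits the axis by a
vertical step, with source `S` on the axis; `q` is the weight of an edge. -/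
structure SolvesKilledSystem (q : ℝ≥0∞) (S : ℤ → ℝ≥0∞) (f : ℤ → ℤ → ℝ≥0∞) : Prop where
  axis : ∀ x, f x 0 = S x + q * f (x - 1) 0
  off_axis : ∀ x y, y ≠ 0 → f x y = q * (f x (y + 1) + f x (y - 1) + f (x - horizontalStep y) y)

/-- A bounded solution of the killed system is unique. -/
theorem SolvesKilledSystem.unique {q : ℝ≥0∞} (hq : 3 * q < 1) {S : ℤ → ℝ≥0∞}
    {f g : ℤ → ℤ → ℝ≥0∞} (hf : SolvesKilledSystem q S f) (hg : SolvesKilledSystem q S g)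
    {C : ℝ≥0∞} (hC : C ≠ ⊤) (hfC : ∀ x y, f x y ≤ C) (hgC : ∀ x y, g x y ≤ C) : f = g := by
  have hftop : ∀ x y, f x y ≠ ⊤ := fun x y => ne_top_of_le_ne_top hC (hfC x y)
  have hgtop : ∀ x y, g x y ≠ ⊤ := fun x y => ne_top_of_le_ne_top hC (hgC x y)
  have hqtop : q ≠ ⊤ := by
    rintro rfl
    simp at hq
  have h3q : 3 * q.toReal < 1 := by
    have := (ENNReal.toReal_lt_toReal (ENNReal.mul_ne_top (by norm_num) hqtop)
      ENNReal.one_ne_top).2 hq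
    simpa using this
  have hq0 : 0 ≤ q.toReal := ENNReal.toReal_nonneg
  have hStop : ∀ x, S x ≠ ⊤ := fun x =>
    ne_top_of_le_ne_top (hftop x 0) ((hf.axis x).symm ▸ le_self_add)
  -- The difference of two solutions satisfies the homogeneous system, where each value is `q` times
  -- a sum of at most three others. Each iteration improves the uniform bound by the factor `3 * q`.
  have key : ∀ n : ℕ, ∀ x y, |(f x y).toReal - (g x y).toReal| ≤ C.toReal * (3 * q.toReal) ^ n := by
    intro n
    induction n with
    | zero =>
      intro x y
      have h1 := (ENNReal.toReal_le_toReal (hftop x y) hC).2 (hfC x y)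
      have h2 := (ENNReal.toReal_le_toReal (hgtop x y) hC).2 (hgC x y)
      have h3 := ENNReal.toReal_nonneg (a := f x y)
      have h4 := ENNReal.toReal_nonneg (a := g x y)
      rw [pow_zero, mul_one, abs_le]
      constructor <;> linarith
    | succ n ih =>
      intro x y
      by_cases hy : y = 0
      · subst hy
        have hb : 0 ≤ C.toReal * (3 * q.toReal) ^ n := by positivity
        rw [hf.axis, hg.axis, ENNReal.toReal_add (hStop x) (ENNReal.mul_ne_top hqtop (hftop _ _)),
          ENNReal.toReal_add (hStop x) (ENNReal.mul_ne_top hqtop (hgtop _ _)),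
          ENNReal.toReal_mul, ENNReal.toReal_mul, add_sub_add_left_eq_sub, ← mul_sub, abs_mul,
          abs_of_nonneg hq0]
        calc q.toReal * _ ≤ q.toReal * (C.toReal * (3 * q.toReal) ^ n) :=
              mul_le_mul_of_nonneg_left (ih (x - 1) 0) hq0
          _ ≤ 3 * q.toReal * (C.toReal * (3 * q.toReal) ^ n) :=
              mul_le_mul_of_nonneg_right (by linarith) hb
          _ = _ := by ring
      · have e : ∀ {u : ℤ → ℤ → ℝ≥0∞}, (∀ x y, u x y ≠ ⊤) → (q * (u x (y + 1) + u x (y - 1) +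
            u (x - horizontalStep y) y)).toReal = q.toReal * ((u x (y + 1)).toReal +
            (u x (y - 1)).toReal + (u (x - horizontalStep y) y).toReal) := by
          intro u hu
          rw [ENNReal.toReal_mul, ENNReal.toReal_add (ENNReal.add_ne_top.2 ⟨hu _ _, hu _ _⟩)
            (hu _ _), ENNReal.toReal_add (hu _ _) (hu _ _)]
        rw [hf.off_axis x y hy, hg.off_axis x y hy, e hftop, e hgtop, ← mul_sub, abs_mul,
          abs_of_nonneg hq0]
        have h1 := abs_le.1 (ih x (y + 1))
        have h2 := abs_le.1 (ih x (y - 1))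
        have h3 := abs_le.1 (ih (x - horizontalStep y) y)
        calc q.toReal * _ ≤ q.toReal * (3 * (C.toReal * (3 * q.toReal) ^ n)) := by
              refine mul_le_mul_of_nonneg_left (abs_le.2 ⟨?_, ?_⟩) hq0 <;> linarith
          _ = _ := by ring
  funext x y
  rw [← ENNReal.toReal_eq_toReal_iff' (hftop x y) (hgtop x y), ← sub_eq_zero, ← abs_eq_zero]
  have hlim : Tendsto (fun n : ℕ => C.toReal * (3 * q.toReal) ^ n) atTop (nhds 0) := by
    simpa using (tendsto_pow_atTop_nhds_zero_of_lt_one (r := 3 * q.toReal) (by positivity)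
      h3q).const_mul C.toReal
  exact le_antisymm (ge_of_tendsto' hlim fun n => key n x y) (abs_nonneg _)

/-- Probability that the walk started at height one of the half plane, with all horizontal steps to
the right, is at `(k, y)` at time `u` and has not left the set of positive heights. -/
noncomputable def halfPlaneProb : ℕ → ℤ → ℤ → ℝ≥0∞
  | 0, k, y => if k = 0 ∧ y = 1 then 1 else 0
  | u + 1, k, y => if 1 ≤ y then
      3⁻¹ * (halfPlaneProb u k (y + 1) + halfPlaneProb u k (y - 1) + halfPlaneProb u (k - 1) y)
    else 0

theorem halfPlaneProb_of_nonpos (u : ℕ) (k : ℤ) {y : ℤ} (hy : y ≤ 0) : halfPlaneProb u k y = 0 := by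
  cases u with
  | zero => simp only [halfPlaneProb, ite_eq_right_iff]; omega
  | succ u => simp only [halfPlaneProb, ite_eq_right_iff]; omega

theorem halfPlaneProb_of_neg (u : ℕ) {k : ℤ} (hk : k < 0) (y : ℤ) : halfPlaneProb u k y = 0 := by
  induction u generalizing k y with
  | zero => simp only [halfPlaneProb, ite_eq_right_iff]; omega
  | succ u ih => simp [halfPlaneProb, ih hk, ih (show k - 1 < 0 by omega)]

/-- The displacement is at most the elapsed time; this gives the discounted return law a finite
first moment in `summable_nat_mul_returnLaw`. -/
theorem halfPlaneProb_of_lt (u : ℕ) {k : ℤ} (hk : u < k) (y : ℤ) : halfPlaneProb u k y = 0 := by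
  induction u generalizing k y with
  | zero => simp only [halfPlaneProb, ite_eq_right_iff]; omega
  | succ u ih =>
    have h1 : (u : ℤ) < k := by push_cast at hk; omega
    have h2 : (u : ℤ) < k - 1 := by push_cast at hk; omega
    simp [halfPlaneProb, ih h1, ih h2]

theorem three_inv_mul_three : (3⁻¹ : ℝ≥0∞) * (1 + 1 + 1) = 1 := by
  have : (1 + 1 + 1 : ℝ≥0∞) = 3 := by norm_num
  rw [this]
  exact ENNReal.inv_mul_cancel (by norm_num) (by norm_num)

theorem tsum_halfPlaneProb_le (u : ℕ) (y : ℤ) : ∑' k, halfPlaneProb u k y ≤ 1 := by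
  induction u generalizing y with
  | zero =>
    rw [tsum_eq_single 0]
    · simp only [halfPlaneProb]; split_ifs <;> simp
    · intro k hk; simp [halfPlaneProb, hk]
  | succ u ih =>
    by_cases hy : 1 ≤ y
    · simp only [halfPlaneProb, hy, if_true]
      rw [ENNReal.tsum_mul_left, ENNReal.tsum_add, ENNReal.tsum_add]
      have : ∑' k : ℤ, halfPlaneProb u (k - 1) y = ∑' k, halfPlaneProb u k y :=
        (Equiv.subRight (1 : ℤ)).tsum_eq fun k => halfPlaneProb u k y
      rw [this, ← three_inv_mul_three]
      gcongr <;> apply ih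
    · simp [halfPlaneProb, hy]

theorem halfPlaneProb_le (u : ℕ) (k y : ℤ) : halfPlaneProb u k y ≤ 1 :=
  (ENNReal.le_tsum k).trans (tsum_halfPlaneProb_le u y)

/-- Green function of the walk of `halfPlaneProb`. -/
noncomputable def halfPlaneGreen (r : ℝ≥0∞) (k y : ℤ) : ℝ≥0∞ :=
  genFun r fun u => halfPlaneProb u k y

theorem halfPlaneGreen_eq (r : ℝ≥0∞) (k : ℤ) {y : ℤ} (hy : 1 ≤ y) :
    halfPlaneGreen r k y = (if k = 0 ∧ y = 1 then 1 else 0) + r * 3⁻¹ * (halfPlaneGreen r k (y + 1) +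
      halfPlaneGreen r k (y - 1) + halfPlaneGreen r (k - 1) y) := by
  unfold halfPlaneGreen
  rw [genFun_succ]
  simp only [halfPlaneProb, hy, if_true]
  rw [genFun_const_mul, genFun_add, genFun_add, mul_assoc]

theorem halfPlaneGreen_zero (r : ℝ≥0∞) (k : ℤ) : halfPlaneGreen r k 0 = 0 := by
  simp [halfPlaneGreen, halfPlaneProb_of_nonpos, genFun_zero]

theorem halfPlaneGreen_of_neg (r : ℝ≥0∞) {k : ℤ} (hk : k < 0) (y : ℤ) :
    halfPlaneGreen r k y = 0 := by
  simp [halfPlaneGreen, halfPlaneProb_of_neg _ hk, genFun_zero]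

theorem halfPlaneGreen_le (r : ℝ≥0∞) (k y : ℤ) : halfPlaneGreen r k y ≤ (1 - r)⁻¹ :=
  genFun_le r fun u => halfPlaneProb_le u k y

theorem tsum_halfPlaneGreen_le (r : ℝ≥0∞) (y : ℤ) : ∑' k, halfPlaneGreen r k y ≤ (1 - r)⁻¹ := by
  unfold halfPlaneGreen
  rw [← genFun_tsum]
  exact genFun_le r fun u => tsum_halfPlaneProb_le u y

/-- Law of the time-discounted horizontal displacement during the stay on the axis, including the
vertical step that ends it. -/
noncomputable def axisLaw (q : ℝ≥0∞) (j : ℤ) : ℝ≥0∞ := if 0 ≤ j then q ^ (j.toNat + 1) else 0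

theorem axisLaw_eq (q : ℝ≥0∞) (j : ℤ) :
    axisLaw q j = (if j = 0 then q else 0) + q * axisLaw q (j - 1) := by
  unfold axisLaw
  rcases lt_trichotomy j 0 with h | rfl | h
  · simp [not_le.2 h, h.ne, show ¬ (1 ≤ j) by omega]
  · simp
  · have : j.toNat = (j - 1).toNat + 1 := by omega
    rw [if_pos h.le, if_neg h.ne', if_pos (show 0 ≤ j - 1 by omega), zero_add, ← this, pow_succ']

theorem tsum_axisLaw (q : ℝ≥0∞) : ∑' j, axisLaw q j = q * (1 - q)⁻¹ := by
  rw [← ENNReal.tsum_geometric, ← ENNReal.tsum_mul_left, ← (Nat.cast_injective (R := ℤ)).tsum_eq]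
  · exact tsum_congr fun n => by simp [axisLaw, pow_succ']
  · intro j hj
    have : 0 ≤ j := by
      by_contra hc
      exact hj (by simp [axisLaw, hc])
    exact ⟨j.toNat, by simp [this]⟩

/-- Discounted law of the horizontal displacement (in absolute value) from a vertical departure
from the axis until the return to it. -/
noncomputable def returnLaw (r : ℝ≥0∞) (k : ℤ) : ℝ≥0∞ := r * 3⁻¹ * halfPlaneGreen r k 1

/-- The bounded solution of the killed system with unit source at the origin. -/
noncomputable def killedGreen (r : ℝ≥0∞) (z y : ℤ) : ℝ≥0∞ :=
  if y = 0 then (if 0 ≤ z then (r * 3⁻¹) ^ z.toNat else 0)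
  else if 0 < y then ∑' j, axisLaw (r * 3⁻¹) j * halfPlaneGreen r (z - j) y
  else ∑' j, axisLaw (r * 3⁻¹) j * halfPlaneGreen r (j - z) (-y)

theorem mul_killedGreen_zero (r : ℝ≥0∞) (z : ℤ) :
    r * 3⁻¹ * killedGreen r z 0 = axisLaw (r * 3⁻¹) z := by
  simp [killedGreen, axisLaw, pow_succ']

theorem killedGreen_of_pos (r : ℝ≥0∞) (z : ℤ) {y : ℤ} (hy : 0 < y) :
    killedGreen r z y = ∑' j, axisLaw (r * 3⁻¹) j * halfPlaneGreen r (z - j) y := by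
  simp [killedGreen, hy, hy.ne']

theorem killedGreen_of_neg (r : ℝ≥0∞) (z : ℤ) {y : ℤ} (hy : y < 0) :
    killedGreen r z y = ∑' j, axisLaw (r * 3⁻¹) j * halfPlaneGreen r (j - z) (-y) := by
  simp [killedGreen, not_lt.2 hy.le, hy.ne]

/-- A path without a new hit drifts along the axis for `j` steps and then stays in one open half
plane. The lower half plane is the mirror image of the upper one in both coordinates, whence the
arguments `j - z` and `-y`. -/
theorem killedGreen_solves (r : ℝ≥0∞) :
    SolvesKilledSystem (r * 3⁻¹) (fun z => if z = 0 then 1 else 0) (killedGreen r) := by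
  constructor
  · intro z
    simp only [killedGreen, if_true]
    rcases lt_trichotomy z 0 with h | rfl | h
    · simp [not_le.2 h, h.ne, show ¬ (1 ≤ z) by omega]
    · simp
    · have : z.toNat = (z - 1).toNat + 1 := by omega
      rw [if_pos h.le, if_neg h.ne', if_pos (show 0 ≤ z - 1 by omega), zero_add, this, pow_succ']
  · intro z y hy
    have hsplit : ∀ (d : ℤ → ℤ) (y' : ℤ), 1 ≤ y' →
        ∑' j, axisLaw (r * 3⁻¹) j * halfPlaneGreen r (d j) y' =
          (∑' j, axisLaw (r * 3⁻¹) j * (if d j = 0 ∧ y' = 1 then 1 else 0)) +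
          r * 3⁻¹ * ((∑' j, axisLaw (r * 3⁻¹) j * halfPlaneGreen r (d j) (y' + 1)) +
          (∑' j, axisLaw (r * 3⁻¹) j * halfPlaneGreen r (d j) (y' - 1)) +
          ∑' j, axisLaw (r * 3⁻¹) j * halfPlaneGreen r (d j - 1) y') := by
      intro d y' hy'
      rw [← ENNReal.tsum_add, ← ENNReal.tsum_add, ← ENNReal.tsum_mul_left, ← ENNReal.tsum_add]
      refine tsum_congr fun j => ?_
      rw [halfPlaneGreen_eq r (d j) hy']
      ring
    -- The unit source of the half-plane Green function at height one, averaged over the departure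
    -- point, is exactly the flow from the axis into heights `1` and `-1`.
    have hpoint : ∀ (d : ℤ → ℤ), (∀ j, d j = 0 ↔ j = z) →
        ∑' j, axisLaw (r * 3⁻¹) j * (if d j = 0 ∧ (1 : ℤ) = 1 then 1 else 0) =
          r * 3⁻¹ * killedGreen r z 0 := by
      intro d hd
      rw [tsum_eq_single z, mul_killedGreen_zero]
      · simp [(hd z).2 rfl]
      · intro j hj; simp [mt (hd j).1 hj]
    rcases lt_or_gt_of_ne hy with hy | hy
    · have hh : horizontalStep y = -1 := by simp [horizontalStep, not_le.2 hy]
      rw [killedGreen_of_neg r z hy, hsplit _ _ (by omega), killedGreen_of_neg r z (show y - 1 < 0 by omega),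
        hh, killedGreen_of_neg r _ hy, show -(y - 1) = -y + 1 by ring]
      have e1 : ∀ j : ℤ, j - (z - -1) = j - z - 1 := fun j => by ring
      simp_rw [e1]
      by_cases h1 : y = -1
      · subst h1
        rw [show (- -1 : ℤ) = 1 by norm_num, hpoint _ (fun j => by omega)]
        simp only [sub_self, halfPlaneGreen_zero, mul_zero, tsum_zero, Int.reduceNeg,
          neg_add_cancel]
        ring
      · rw [killedGreen_of_neg r z (show y + 1 < 0 by omega), show -(y + 1) = -y - 1 by ring]
        simp only [show ¬ (-y = 1) by omega, and_false, if_false, mul_zero, tsum_zero, zero_add]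
        ring
    · have hh : horizontalStep y = 1 := by simp [horizontalStep, hy.le]
      rw [killedGreen_of_pos r z hy, hsplit _ _ (by omega), killedGreen_of_pos r z (show 0 < y + 1 by omega),
        hh, killedGreen_of_pos r _ hy]
      have e1 : ∀ j : ℤ, z - 1 - j = z - j - 1 := fun j => by ring
      simp_rw [e1]
      by_cases h1 : y = 1
      · subst h1
        rw [hpoint _ (fun j => by omega)]
        simp only [sub_self, halfPlaneGreen_zero, mul_zero, tsum_zero]
        ring
      · rw [killedGreen_of_pos r z (show 0 < y - 1 by omega)]
        simp only [h1, and_false, if_false, mul_zero, tsum_zero, zero_add]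

theorem killedGreen_le {r : ℝ≥0∞} (hr : r < 1) (z y : ℤ) : killedGreen r z y ≤ (1 - r)⁻¹ := by
  have hq : r * 3⁻¹ ≤ 3⁻¹ := mul_le_of_le_one_left' hr.le
  have h3 : (3 : ℝ≥0∞)⁻¹ ≤ 1 := ENNReal.inv_le_one.2 (by norm_num)
  have h1 : (1 : ℝ≥0∞) ≤ (1 - r)⁻¹ := ENNReal.one_le_inv.2 tsub_le_self
  have hsum : ∀ d : ℤ → ℤ, ∀ y', ∑' j, axisLaw (r * 3⁻¹) j * halfPlaneGreen r (d j) y' ≤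
      (1 - r)⁻¹ := by
    intro d y'
    calc _ ≤ ∑' j, axisLaw (r * 3⁻¹) j * (1 - r)⁻¹ :=
          ENNReal.tsum_le_tsum fun j => mul_le_mul_right (halfPlaneGreen_le r _ _) _
      _ = r * 3⁻¹ * (1 - r * 3⁻¹)⁻¹ * (1 - r)⁻¹ := by rw [ENNReal.tsum_mul_right, tsum_axisLaw]
      _ ≤ 1 * (1 - r)⁻¹ := by
          refine mul_le_mul_left ?_ _
          rw [← div_eq_mul_inv]
          refine ENNReal.div_le_of_le_mul ?_
          rw [one_mul]
          refine ENNReal.le_sub_of_add_le_right ?_ ?_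
          · exact ne_top_of_le_ne_top (by norm_num) hq
          calc r * 3⁻¹ + r * 3⁻¹ ≤ 3⁻¹ + 3⁻¹ := add_le_add hq hq
            _ ≤ 3⁻¹ * (1 + 1 + 1) := by rw [mul_add, mul_add, mul_one]; exact le_self_add
            _ = 1 := three_inv_mul_three
      _ = _ := one_mul _
  unfold killedGreen
  split_ifs
  · exact (pow_le_one' (hq.trans h3) _).trans h1
  · exact zero_le
  · exact hsum _ _
  · exact hsum _ _

/-! ### Renewal equations; half windings compared with crossings -/

section Green

variable {Ω : Type*} [MeasurableSpace Ω]

/-- Discounted number of hits of the axis at abscissa `m`. -/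
noncomputable def hitGreen (μ : Measure Ω) (M : ℕ → Ω → ℤ × ℤ) (r : ℝ≥0∞) (m : ℤ) : ℝ≥0∞ :=
  genFun r fun t => hitProb μ M t m

/-- Discounted occupation of `(x, y)` while the last hit of the axis is at abscissa `m`. -/
noncomputable def lastHitGreen (μ : Measure Ω) (M : ℕ → Ω → ℤ × ℤ) (r : ℝ≥0∞) (m x y : ℤ) :
    ℝ≥0∞ :=
  genFun r fun t => lastHitProb μ M t m x y

/-- Discounted number of vertical departures from the axis at abscissa `e`. -/
noncomputable def exitGreen (μ : Measure Ω) (M : ℕ → Ω → ℤ × ℤ) (r : ℝ≥0∞) (e : ℤ) : ℝ≥0∞ :=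
  ∑' m, hitGreen μ M r m * axisLaw (r * 3⁻¹) (e - m)

/-- Discounted number of excursions away from the axis whose horizontal displacement `k` exceeds
the distance of their departure point `(e, 0)` to the origin. -/
noncomputable def crossingGreen (μ : Measure Ω) (M : ℕ → Ω → ℤ × ℤ) (r : ℝ≥0∞) : ℝ≥0∞ :=
  ∑' e, exitGreen μ M r e * ∑' k, if |e| < k then returnLaw r k else 0

/-- Discounted number of passages through the origin during a stay on the axis. -/
noncomputable def originGreen (μ : Measure Ω) (M : ℕ → Ω → ℤ × ℤ) (r : ℝ≥0∞) : ℝ≥0∞ :=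
  ∑' m, ∑' e, if m ≤ 0 ∧ 0 ≤ e then hitGreen μ M r m * axisLaw (r * 3⁻¹) (e - m) else 0

variable {μ : Measure Ω} [IsProbabilityMeasure μ] {M : ℕ → Ω → ℤ × ℤ} {r : ℝ≥0∞}

theorem hitGreen_le (μ : Measure Ω) [IsProbabilityMeasure μ] (M : ℕ → Ω → ℤ × ℤ) (r : ℝ≥0∞)
    (m : ℤ) : hitGreen μ M r m ≤ (1 - r)⁻¹ :=
  genFun_le r fun _ => prob_le_one

theorem tsum_hitGreen_le (h : IsSimpleRandomWalk graphG1 (0, 0) μ M) :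
    ∑' m, hitGreen μ M r m ≤ (1 - r)⁻¹ := by
  unfold hitGreen
  rw [← genFun_tsum]
  refine genFun_le r fun t => ?_
  unfold hitProb
  rw [← measure_iUnion]
  · exact prob_le_one
  · intro m m' hne
    refine Set.disjoint_left.2 fun ω h1 h2 => hne ?_
    exact congrArg Prod.fst (h1.2.symm.trans h2.2)
  · intro m
    exact ((dependsOnPrefix_hitsAxis le_rfl).and
      (dependsOnPrefix_apply le_rfl fun v => v = (m, 0))).measurableSet h.measurable

omit [IsProbabilityMeasure μ] in
theorem lastHitGreen_solves (h : IsSimpleRandomWalk graphG1 (0, 0) μ M) (r : ℝ≥0∞) (m : ℤ) :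
    SolvesKilledSystem (r * 3⁻¹) (fun x => if x = m then hitGreen μ M r m else 0)
      (lastHitGreen μ M r m) := by
  constructor
  · intro x
    unfold lastHitGreen
    rw [genFun_succ, lastHitProb_zero]
    simp only [lastHitProb_succ_zero h]
    rw [genFun_add, genFun_const_mul, hitGreen, genFun_succ r fun t => hitProb μ M t m]
    by_cases hx : x = m
    · simp only [hx, if_true, and_self]
      ring
    · simp only [hx, if_false, and_false, genFun_zero]
      ring
  · intro x y hy
    unfold lastHitGreen
    rw [genFun_succ, lastHitProb_zero]
    simp only [lastHitProb_succ_of_ne h _ _ _ hy]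
    rw [genFun_const_mul, genFun_add, genFun_add]
    simp [hy, mul_assoc]

/-- Renewal at the last hit: both sides are bounded solutions of the same killed system, with source
of mass `hitGreen` at `m`, so uniqueness identifies them. -/
theorem lastHitGreen_eq (h : IsSimpleRandomWalk graphG1 (0, 0) μ M) (hr : r < 1) (m x y : ℤ) :
    lastHitGreen μ M r m x y = hitGreen μ M r m * killedGreen r (x - m) y := by
  have h1 : (1 : ℝ≥0∞) ≤ (1 - r)⁻¹ := ENNReal.one_le_inv.2 tsub_le_self
  have hk := killedGreen_solves r
  have hsol : SolvesKilledSystem (r * 3⁻¹) (fun x => if x = m then hitGreen μ M r m else 0)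
      (fun x y => hitGreen μ M r m * killedGreen r (x - m) y) := by
    constructor
    · intro x
      rw [hk.axis, sub_right_comm]
      by_cases hx : x = m
      · simp only [hx, sub_self, if_true]; ring
      · simp only [hx, sub_eq_zero, if_false]; ring
    · intro x y hy
      rw [hk.off_axis _ _ hy, sub_right_comm x (horizontalStep y)]
      ring
  refine congrFun₂ ((lastHitGreen_solves h r m).unique ?_ hsol
    (C := (1 - r)⁻¹ * (1 - r)⁻¹) ?_ ?_ ?_) x y
  · rw [mul_left_comm, ENNReal.mul_inv_cancel (by norm_num) (by norm_num), mul_one]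
    exact hr
  · exact ENNReal.mul_ne_top (inv_one_sub_ne_top hr) (inv_one_sub_ne_top hr)
  · intro x y
    exact (genFun_le r fun _ => prob_le_one).trans (le_mul_of_one_le_left' h1)
  · intro x y
    exact mul_le_mul' (hitGreen_le μ M r m) (killedGreen_le hr _ _)

theorem lastHitGreen_return (h : IsSimpleRandomWalk graphG1 (0, 0) μ M) (hr : r < 1) (m m' : ℤ) :
    r * 3⁻¹ * (lastHitGreen μ M r m m' 1 + lastHitGreen μ M r m m' (-1)) =
      ∑' e, hitGreen μ M r m * axisLaw (r * 3⁻¹) (e - m) *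
        (returnLaw r (m' - e) + returnLaw r (e - m')) := by
  rw [lastHitGreen_eq h hr, lastHitGreen_eq h hr, killedGreen_of_pos r _ one_pos,
    killedGreen_of_neg r _ (by norm_num : (-1 : ℤ) < 0), ← mul_add, ← ENNReal.tsum_add,
    ← ENNReal.tsum_mul_left, ← ENNReal.tsum_mul_left, ← (Equiv.subRight m).tsum_eq]
  refine tsum_congr fun e => ?_
  simp only [Equiv.subRight_apply, returnLaw, neg_neg]
  rw [show m' - m - (e - m) = m' - e by ring, show e - m - (m' - m) = e - m' by ring]
  ring

/-- Every hit other than the one at time 0 ends an excursion from some departure point `e`, above or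
below the axis. -/
theorem hitGreen_eq (h : IsSimpleRandomWalk graphG1 (0, 0) μ M) (hr : r < 1) (m' : ℤ) :
    hitGreen μ M r m' = (if m' = 0 then 1 else 0) +
      ∑' e, exitGreen μ M r e * (returnLaw r (m' - e) + returnLaw r (e - m')) := by
  have h2 : ∑' e, exitGreen μ M r e * (returnLaw r (m' - e) + returnLaw r (e - m')) =
      ∑' m, r * 3⁻¹ * (lastHitGreen μ M r m m' 1 + lastHitGreen μ M r m m' (-1)) := by
    simp_rw [lastHitGreen_return h hr, exitGreen, ← ENNReal.tsum_mul_right]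
    exact ENNReal.tsum_comm
  rw [h2, ENNReal.tsum_mul_left, ENNReal.tsum_add]
  unfold hitGreen lastHitGreen
  rw [← genFun_tsum, ← genFun_tsum, genFun_succ, hitProb_zero h]
  simp only [hitProb_succ h, tsum_lastHitProb h]
  rw [genFun_const_mul, genFun_add, mul_assoc]

-- Decomposition of a half winding by the preceding hit `m`, the departure point `e` and the
-- displacement `k`; the two indicators correspond to upper and lower excursions.
open Classical in
theorem genFun_halfWindingProb (h : IsSimpleRandomWalk graphG1 (0, 0) μ M) (hr : r < 1) :
    genFun r (halfWindingProb μ M) = ∑' m, ∑' e, hitGreen μ M r m * axisLaw (r * 3⁻¹) (e - m) *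
      ∑' k, returnLaw r k * ((if OppositeSides m (e + k) then 1 else 0) +
        if OppositeSides m (e - k) then 1 else 0) := by
  rw [genFun_succ, halfWindingProb_zero, zero_add]
  simp only [halfWindingProb_succ h]
  rw [genFun_tsum, ← ENNReal.tsum_mul_left]
  refine tsum_congr fun m => ?_
  rw [genFun_tsum, ← ENNReal.tsum_mul_left]
  have e1 : ∀ m' : ℤ, r * genFun r (fun t => if OppositeSides m m' then
      3⁻¹ * (lastHitProb μ M t m m' 1 + lastHitProb μ M t m m' (-1)) else 0) =
      ∑' e, hitGreen μ M r m * axisLaw (r * 3⁻¹) (e - m) * ((returnLaw r (m' - e) +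
        returnLaw r (e - m')) * if OppositeSides m m' then 1 else 0) := by
    intro m'
    split_ifs with ho
    · rw [genFun_const_mul, genFun_add, ← mul_assoc]
      simp only [mul_one]
      exact lastHitGreen_return h hr m m'
    · simp [genFun_zero]
  simp_rw [e1]
  rw [ENNReal.tsum_comm]
  refine tsum_congr fun e => ?_
  rw [ENNReal.tsum_mul_left]
  congr 1
  simp_rw [add_mul, mul_add, ENNReal.tsum_add]
  congr 1
  · rw [← (Equiv.addLeft e).tsum_eq]
    exact tsum_congr fun k => by
      by_cases ho : OppositeSides m (e + k) <;> simp [ho]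
  · rw [← (Equiv.subLeft e).tsum_eq]
    exact tsum_congr fun k => by simp

/-- If `m` and `e` are both positive, only a lower excursion can change sides; if both are negative,
only an upper one. Away from the origin the two indicators of `genFun_halfWindingProb` thus merge
into the single condition `|e| < k`. -/
theorem oppositeSides_add_sub {m e k : ℤ} (hme : m ≤ e) (hk : 0 ≤ k) (h0 : ¬ (m ≤ 0 ∧ 0 ≤ e)) :
    (OppositeSides m (e + k) ∨ OppositeSides m (e - k) ↔ |e| < k) ∧
      ¬ (OppositeSides m (e + k) ∧ OppositeSides m (e - k)) := by
  unfold OppositeSides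
  rcases lt_trichotomy m 0 with hm | rfl | hm
  · have he : e < 0 := by by_contra hc; exact h0 ⟨hm.le, not_lt.1 hc⟩
    rw [Int.sign_eq_neg_one_of_neg hm, neg_neg, Int.sign_eq_one_iff_pos, Int.sign_eq_one_iff_pos,
      abs_of_neg he]
    omega
  · exact absurd ⟨le_rfl, hme⟩ h0
  · rw [Int.sign_eq_one_of_pos hm, Int.sign_eq_neg_one_iff_neg, Int.sign_eq_neg_one_iff_neg,
      abs_of_pos (hm.trans_le hme)]
    omega

theorem returnLaw_of_neg (r : ℝ≥0∞) {k : ℤ} (hk : k < 0) : returnLaw r k = 0 := by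
  simp [returnLaw, halfPlaneGreen_of_neg r hk]

theorem crossingGreen_eq (μ : Measure Ω) (M : ℕ → Ω → ℤ × ℤ) (r : ℝ≥0∞) :
    crossingGreen μ M r = ∑' m, ∑' e, hitGreen μ M r m * axisLaw (r * 3⁻¹) (e - m) *
      ∑' k, if |e| < k then returnLaw r k else 0 := by
  unfold crossingGreen exitGreen
  simp_rw [← ENNReal.tsum_mul_right]
  rw [ENNReal.tsum_comm]

/-- Terms with `m ≤ 0 ≤ e` are not controlled by `oppositeSides_add_sub`; there each of the two
indicators is bounded by 1, whence the factor 2. -/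
theorem genFun_halfWindingProb_le (h : IsSimpleRandomWalk graphG1 (0, 0) μ M) (hr : r < 1) :
    genFun r (halfWindingProb μ M) ≤
      crossingGreen μ M r + 2 * (∑' k, returnLaw r k) * originGreen μ M r := by
  classical
  rw [genFun_halfWindingProb h hr, crossingGreen_eq, originGreen, ← ENNReal.tsum_mul_left,
    ← ENNReal.tsum_add]
  refine ENNReal.tsum_le_tsum fun m => ?_
  rw [← ENNReal.tsum_mul_left, ← ENNReal.tsum_add]
  refine ENNReal.tsum_le_tsum fun e => ?_
  by_cases hme : m ≤ e
  -- The axis is traversed only to the right, so `e < m` has weight zero.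
  swap
  · simp [axisLaw, hme]
  split_ifs with h0
  · refine le_add_left ?_
    rw [mul_comm (2 * _)]
    refine mul_le_mul_right ?_ _
    rw [mul_comm, ← ENNReal.tsum_mul_right]
    refine ENNReal.tsum_le_tsum fun k => mul_le_mul_right ?_ _
    rw [← one_add_one_eq_two]
    refine add_le_add ?_ ?_ <;> split_ifs <;> simp
  · rw [mul_zero, add_zero]
    refine mul_le_mul_right (ENNReal.tsum_le_tsum fun k => ?_) _
    by_cases hk : 0 ≤ k
    · have := oppositeSides_add_sub hme hk h0
      split_ifs <;> first | tauto | simp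
    · simp [returnLaw_of_neg r (not_le.1 hk)]

theorem crossingGreen_le (h : IsSimpleRandomWalk graphG1 (0, 0) μ M) (hr : r < 1) :
    crossingGreen μ M r ≤
      genFun r (halfWindingProb μ M) + (∑' k, returnLaw r k) * originGreen μ M r := by
  classical
  rw [genFun_halfWindingProb h hr, crossingGreen_eq, originGreen, ← ENNReal.tsum_mul_left,
    ← ENNReal.tsum_add]
  refine ENNReal.tsum_le_tsum fun m => ?_
  rw [← ENNReal.tsum_mul_left, ← ENNReal.tsum_add]
  refine ENNReal.tsum_le_tsum fun e => ?_
  by_cases hme : m ≤ e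
  swap
  · simp [axisLaw, hme]
  split_ifs with h0
  · refine le_add_left ?_
    rw [mul_comm (∑' _, _)]
    refine mul_le_mul_right ?_ _
    refine ENNReal.tsum_le_tsum fun k => ?_
    split_ifs <;> simp
  · rw [mul_zero, add_zero]
    refine mul_le_mul_right (ENNReal.tsum_le_tsum fun k => ?_) _
    by_cases hk : 0 ≤ k
    · have := oppositeSides_add_sub hme hk h0
      split_ifs <;> first | tauto | simp
    · simp [returnLaw_of_neg r (not_le.1 hk)]

omit [IsProbabilityMeasure μ] in
/-- If the Green function of the hits of the axis is bounded by `S`, then the number of passages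
through the origin is of order `S`. -/
theorem originGreen_le (hr : r ≤ 1) {S : ℝ≥0∞} (hS : ∀ m, hitGreen μ M r m ≤ S) :
    originGreen μ M r ≤ S * (3 * ((3⁻¹ * (1 - 3⁻¹)⁻¹) * (3⁻¹ * (1 - 3⁻¹)⁻¹))) := by
  have hq : r * 3⁻¹ ≤ 3⁻¹ := mul_le_of_le_one_left' hr
  calc originGreen μ M r ≤ ∑' m, ∑' e, S * (3 * (axisLaw 3⁻¹ (-m) * axisLaw 3⁻¹ e)) := by
        refine ENNReal.tsum_le_tsum fun m => ENNReal.tsum_le_tsum fun e => ?_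
        split_ifs with h0
        · refine mul_le_mul' (hS m) ?_
          -- The exponent `e - m + 1` is one less than the sum of the exponents `-m + 1` and `e +
          -- 1`; the factor 3 cancels the surplus factor `3⁻¹`, and the double sum factorises.
          have h1 : (e - m).toNat = (-m).toNat + e.toNat := by omega
          rw [axisLaw, axisLaw, axisLaw, if_pos (by omega), if_pos (by omega), if_pos h0.2, h1,
            pow_succ (3⁻¹ : ℝ≥0∞) (-m).toNat, mul_right_comm, mul_left_comm,
            ENNReal.mul_inv_cancel (by norm_num) (by norm_num), mul_one, ← pow_add, ← add_assoc]
          exact pow_le_pow_left' hq _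
        · exact zero_le
    _ = _ := by
        have e1 : ∑' m : ℤ, axisLaw (3⁻¹ : ℝ≥0∞) (-m) = 3⁻¹ * (1 - 3⁻¹)⁻¹ := by
          rw [← tsum_axisLaw]
          exact (Equiv.neg ℤ).tsum_eq _
        simp_rw [ENNReal.tsum_mul_left]
        rw [ENNReal.tsum_mul_right, e1, tsum_axisLaw]

end Green

/-! ### Fourier series of summable sequences -/

/-- Fourier transform of a sequence indexed by `ℤ`. -/
noncomputable def fourierSum (f : ℤ → ℝ) (θ : ℝ) : ℂ :=
  ∑' n : ℤ, (f n : ℂ) * Complex.exp (n * θ * Complex.I)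

theorem norm_exp_int_mul (n : ℤ) (θ : ℝ) : ‖Complex.exp (n * θ * Complex.I)‖ = 1 := by
  have := Complex.norm_exp_ofReal_mul_I (n * θ)
  push_cast at this
  exact this

theorem summable_norm_fourierSum {f : ℤ → ℝ} (hf : Summable f) (θ : ℝ) :
    Summable fun n : ℤ => ‖(f n : ℂ) * Complex.exp (n * θ * Complex.I)‖ := by
  simp_rw [norm_mul, norm_exp_int_mul, mul_one, Complex.norm_real]
  exact hf.norm

theorem summable_fourierSum {f : ℤ → ℝ} (hf : Summable f) (θ : ℝ) :
    Summable fun n : ℤ => (f n : ℂ) * Complex.exp (n * θ * Complex.I) :=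
  (summable_norm_fourierSum hf θ).of_norm

theorem norm_fourierSum_le {f : ℤ → ℝ} (hf : Summable f) (hf0 : ∀ n, 0 ≤ f n) (θ : ℝ) :
    ‖fourierSum f θ‖ ≤ ∑' n, f n := by
  refine (norm_tsum_le_tsum_norm (summable_norm_fourierSum hf θ)).trans_eq (tsum_congr fun n => ?_)
  rw [norm_mul, norm_exp_int_mul, mul_one, Complex.norm_real, Real.norm_of_nonneg (hf0 n)]

theorem continuous_fourierSum {f : ℤ → ℝ} (hf : Summable f) : Continuous (fourierSum f) := by
  refine continuous_tsum (u := fun n => ‖f n‖) (fun n => by fun_prop) hf.norm fun n θ => ?_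
  rw [norm_mul, norm_exp_int_mul, mul_one, Complex.norm_real]

theorem fourierSum_single (a : ℝ) (θ : ℝ) : fourierSum (fun n => if n = 0 then a else 0) θ = a := by
  unfold fourierSum
  rw [tsum_eq_single 0]
  · simp
  · intro n hn; simp [hn]

theorem fourierSum_add {f g : ℤ → ℝ} (hf : Summable f) (hg : Summable g) (θ : ℝ) :
    fourierSum (fun n => f n + g n) θ = fourierSum f θ + fourierSum g θ := by
  unfold fourierSum
  rw [← (summable_fourierSum hf θ).tsum_add (summable_fourierSum hg θ)]
  exact tsum_congr fun n => by push_cast; ring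

theorem fourierSum_const_mul (a : ℝ) (f : ℤ → ℝ) (θ : ℝ) :
    fourierSum (fun n => a * f n) θ = a * fourierSum f θ := by
  unfold fourierSum
  rw [← tsum_mul_left]
  exact tsum_congr fun n => by push_cast; ring

theorem fourierSum_shift (f : ℤ → ℝ) (θ : ℝ) :
    fourierSum (fun n => f (n - 1)) θ = Complex.exp (θ * Complex.I) * fourierSum f θ := by
  unfold fourierSum
  rw [← tsum_mul_left, ← (Equiv.addRight (1 : ℤ)).tsum_eq]
  refine tsum_congr fun n => ?_
  simp only [Equiv.coe_addRight, add_sub_cancel_right, Int.cast_add, Int.cast_one]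
  rw [add_mul, add_mul, one_mul, Complex.exp_add]
  ring

theorem fourierSum_neg (f : ℤ → ℝ) (θ : ℝ) :
    fourierSum (fun n => f (-n)) θ = (starRingEnd ℂ) (fourierSum f θ) := by
  unfold fourierSum
  rw [Complex.conj_tsum, ← (Equiv.neg ℤ).tsum_eq]
  refine tsum_congr fun n => ?_
  simp [← Complex.exp_conj]

theorem fourierSum_conv {f g : ℤ → ℝ} (hf : Summable f) (hg : Summable g) (θ : ℝ) :
    fourierSum (fun n => ∑' m, f m * g (n - m)) θ = fourierSum f θ * fourierSum g θ := by
  unfold fourierSum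
  have hs := summable_mul_of_summable_norm (summable_norm_fourierSum hf θ)
    (summable_norm_fourierSum hg θ)
  rw [tsum_mul_tsum_of_summable_norm (summable_norm_fourierSum hf θ)
    (summable_norm_fourierSum hg θ)]
  let E : ℤ × ℤ ≃ ℤ × ℤ :=
    { toFun := fun p => (p.2, p.1 - p.2)
      invFun := fun p => (p.1 + p.2, p.1)
      left_inv := fun p => by simp
      right_inv := fun p => by simp }
  rw [← E.tsum_eq]
  refine Eq.trans (tsum_congr fun n => ?_) (E.summable_iff.2 hs).tsum_prod.symm
  rw [Complex.ofReal_tsum, ← tsum_mul_right]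
  refine tsum_congr fun m => ?_
  have : Complex.exp (n * θ * Complex.I) =
      Complex.exp (m * θ * Complex.I) * Complex.exp ((n - m : ℤ) * θ * Complex.I) := by
    rw [← Complex.exp_add]; congr 1; push_cast; ring
  simp only [E, Function.comp, Equiv.coe_fn_mk]
  rw [this]
  push_cast
  ring

theorem integral_exp_int_mul (n : ℤ) :
    ∫ θ in (-Real.pi)..Real.pi, Complex.exp (n * θ * Complex.I) =
      if n = 0 then (2 * Real.pi : ℂ) else 0 := by
  split_ifs with hn
  · subst hn
    simp; ring
  · have hc : (n * Complex.I : ℂ) ≠ 0 := by simp [hn]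
    have e1 : ∀ θ : ℝ, (n * θ * Complex.I : ℂ) = n * Complex.I * θ := fun θ => by ring
    simp_rw [e1]
    rw [integral_exp_mul_complex hc]
    have e2 : Complex.exp (n * Complex.I * (Real.pi : ℝ)) =
        Complex.exp (n * Complex.I * ((-Real.pi : ℝ) : ℂ)) := by
      rw [Complex.exp_eq_exp_iff_exists_int]
      exact ⟨n, by push_cast; ring⟩
    rw [e2, sub_self, zero_div]

/-- Fourier inversion. -/
theorem integral_fourierSum_mul {f : ℤ → ℝ} (hf : Summable f) (m : ℤ) :
    ∫ θ in (-Real.pi)..Real.pi, fourierSum f θ * Complex.exp (-(m * θ * Complex.I)) =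
      2 * Real.pi * f m := by
  have h := intervalIntegral.hasSum_integral_of_dominated_convergence (μ := volume)
    (a := -Real.pi) (b := Real.pi)
    (F := fun (n : ℤ) (θ : ℝ) => (f n : ℂ) * Complex.exp (n * θ * Complex.I) *
      Complex.exp (-(m * θ * Complex.I)))
    (f := fun θ => fourierSum f θ * Complex.exp (-(m * θ * Complex.I)))
    (fun n _ => |f n|)
    (fun n => (by fun_prop : Continuous fun θ : ℝ => (f n : ℂ) * Complex.exp (n * θ * Complex.I) *
      Complex.exp (-(m * θ * Complex.I))).aestronglyMeasurable)
    (fun n => Eventually.of_forall fun θ _ => ?_)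
    (Eventually.of_forall fun θ _ => hf.abs)
    (by simp) (Eventually.of_forall fun θ _ => (summable_fourierSum hf θ).hasSum.mul_right _)
  · rw [← h.tsum_eq, tsum_eq_single m]
    · simp_rw [mul_assoc, ← Complex.exp_add]
      simp
      ring
    · intro n hn
      simp_rw [mul_assoc, ← Complex.exp_add]
      rw [intervalIntegral.integral_const_mul]
      have := integral_exp_int_mul (n - m)
      rw [if_neg (sub_ne_zero.2 hn)] at this
      rw [mul_eq_zero]; right
      rw [← this]
      refine intervalIntegral.integral_congr fun θ _ => ?_
      congr 1; push_cast; ring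
  · have : Complex.exp (-(m * θ * Complex.I)) = Complex.exp (((-m : ℤ) : ℂ) * θ * Complex.I) := by
      congr 1; push_cast; ring
    rw [this, norm_mul, norm_mul, norm_exp_int_mul, norm_exp_int_mul, mul_one, mul_one,
      Complex.norm_real, Real.norm_eq_abs]

/-! ### Characteristic function of the return law -/

/-- A bounded solution of a second order linear recursion is geometric. -/
theorem exists_root_of_bounded_recursion {κ : ℂ} (hκ : 2 < κ.re) {c : ℕ → ℂ} {C : ℝ}
    (hc : ∀ n, ‖c n‖ ≤ C) (hrec : ∀ n, c (n + 2) = κ * c (n + 1) - c n) :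
    ∃ l : ℂ, ‖l‖ < 1 ∧ l ^ 2 + 1 = κ * l ∧ c 1 = l * c 0 := by
  have hroot : ∃ l : ℂ, ‖l‖ ≤ 1 ∧ l ^ 2 + 1 = κ * l := by
    obtain ⟨s, hs⟩ := IsAlgClosed.exists_pow_nat_eq (κ ^ 2 - 4) two_pos
    have hprod : ((κ + s) / 2) * ((κ - s) / 2) = 1 := by
      linear_combination (-1 / 4 : ℂ) * hs
    rcases le_total ‖(κ + s) / 2‖ 1 with h | h
    · exact ⟨_, h, by linear_combination (1 / 4 : ℂ) * hs⟩
    · refine ⟨(κ - s) / 2, ?_, by linear_combination (1 / 4 : ℂ) * hs⟩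
      have h1 := congrArg norm hprod
      rw [norm_mul, norm_one] at h1
      nlinarith [norm_nonneg ((κ - s) / 2)]
  obtain ⟨l, hl1, hl⟩ := hroot
  have hl0 : l ≠ 0 := by rintro rfl; simp at hl
  -- On the unit circle `1/l` is the conjugate of `l`, so `κ` would be `2 Re l ≤ 2`.
  have hlt : ‖l‖ < 1 := by
    refine lt_of_le_of_ne hl1 fun h1 => ?_
    have h2 : l * (starRingEnd ℂ) l = 1 := by
      rw [Complex.mul_conj, Complex.normSq_eq_norm_sq, h1]; simp
    have h3 : κ = l + (starRingEnd ℂ) l := by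
      apply mul_right_cancel₀ hl0
      linear_combination -hl - h2
    have h4 := congrArg Complex.re h3
    simp only [Complex.add_re, Complex.conj_re] at h4
    have h5 := Complex.re_le_norm l
    linarith
  refine ⟨l, hlt, hl, ?_⟩
  -- The combination `c (n + 1) - l * c n` is divided by `l` at each step; being bounded, it must
  -- vanish.
  have hw : ∀ n, (c 1 - l * c 0) = l ^ n * (c (n + 1) - l * c n) := by
    intro n
    induction n with
    | zero => simp
    | succ n ih =>
      rw [ih, hrec n, pow_succ]
      linear_combination (l ^ n * c (n + 1)) * hl
  rw [← sub_eq_zero, ← norm_eq_zero]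
  have hlim : Tendsto (fun n : ℕ => ‖l‖ ^ n * (C + C)) atTop (nhds 0) := by
    simpa using (tendsto_pow_atTop_nhds_zero_of_lt_one (norm_nonneg l) hlt).mul_const (C + C)
  refine le_antisymm (ge_of_tendsto' hlim fun n => ?_) (norm_nonneg _)
  rw [hw n, norm_mul, norm_pow]
  refine mul_le_mul_of_nonneg_left ?_ (by positivity)
  refine (norm_sub_le _ _).trans (add_le_add (hc _) ?_)
  rw [norm_mul]
  exact (mul_le_of_le_one_left (norm_nonneg _) hl1).trans (hc n)

theorem summable_int_single (a : ℝ) : Summable fun n : ℤ => if n = 0 then a else 0 :=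
  summable_of_ne_finset_zero (s := {0}) fun n hn => if_neg (by simpa using hn)

theorem summable_int_shift (f : ℤ → ℝ) (hf : Summable f) : Summable fun n => f (n - 1) :=
  hf.comp_injective (sub_left_injective (b := (1 : ℤ)))

theorem summable_int_neg (f : ℤ → ℝ) (hf : Summable f) : Summable fun n => f (-n) :=
  hf.comp_injective neg_injective

theorem tsum_returnLaw_ne_top {r : ℝ≥0∞} (hr : r < 1) : ∑' k, returnLaw r k ≠ ⊤ := by
  unfold returnLaw
  rw [ENNReal.tsum_mul_left]
  refine ENNReal.mul_ne_top (ENNReal.mul_ne_top hr.ne_top (by norm_num)) ?_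
  exact ne_top_of_le_ne_top (inv_one_sub_ne_top hr) (tsum_halfPlaneGreen_le r 1)

theorem tsum_axisLaw_ne_top {r : ℝ≥0∞} (hr : r < 1) : ∑' j, axisLaw (r * 3⁻¹) j ≠ ⊤ := by
  rw [tsum_axisLaw]
  have h1 : r * 3⁻¹ < 1 :=
    (mul_le_of_le_one_right' (ENNReal.inv_le_one.2 (by norm_num))).trans_lt hr
  exact ENNReal.mul_ne_top h1.ne_top (inv_one_sub_ne_top h1)

theorem toReal_mul_three_inv (r : ℝ≥0∞) : (r * 3⁻¹).toReal = r.toReal / 3 := by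
  simp [div_eq_mul_inv]

/-- The characteristic function of the return law is the small root of a quadratic equation. -/
theorem fourierSum_returnLaw {r : ℝ≥0∞} (hr0 : r ≠ 0) (hr : r < 1) (θ : ℝ) :
    ‖fourierSum (fun k => (returnLaw r k).toReal) θ‖ < 1 ∧
    fourierSum (fun k => (returnLaw r k).toReal) θ ^ 2 + 1 =
      (3 / r.toReal - Complex.exp (θ * Complex.I)) *
        fourierSum (fun k => (returnLaw r k).toReal) θ := by
  have hrr : 0 < r.toReal := ENNReal.toReal_pos hr0 hr.ne_top
  have hrr1 : r.toReal < 1 := by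
    have := (ENNReal.toReal_lt_toReal hr.ne_top ENNReal.one_ne_top).2 hr
    simpa using this
  have hBtop : ∀ y, ∑' k, halfPlaneGreen r k y ≠ ⊤ := fun y =>
    ne_top_of_le_ne_top (inv_one_sub_ne_top hr) (tsum_halfPlaneGreen_le r y)
  have hBsum : ∀ y, Summable fun k => (halfPlaneGreen r k y).toReal := fun y =>
    ENNReal.summable_toReal (hBtop y)
  have hBne : ∀ k y, halfPlaneGreen r k y ≠ ⊤ := fun k y =>
    ENNReal.ne_top_of_tsum_ne_top (hBtop y) k
  have hBs1 : ∀ y, Summable fun k : ℤ => (halfPlaneGreen r (k - 1) y).toReal := fun y =>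
    summable_int_shift (fun k => (halfPlaneGreen r k y).toReal) (hBsum y)
  let b : ℤ → ℂ := fun y => fourierSum (fun k => (halfPlaneGreen r k y).toReal) θ
  have hb0 : b 0 = 0 := by simp [b, halfPlaneGreen_zero, fourierSum]
  have hb : ∀ y : ℤ, 1 ≤ y → b y = (if y = 1 then 1 else 0) + r.toReal / 3 * (b (y + 1) + b (y - 1) +
      Complex.exp (θ * Complex.I) * b y) := by
    intro y hy
    have e1 : (fun k => (halfPlaneGreen r k y).toReal) = fun k : ℤ =>
        (if k = 0 then (if y = 1 then 1 else 0) else (0 : ℝ)) + r.toReal / 3 *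
          ((halfPlaneGreen r k (y + 1)).toReal + (halfPlaneGreen r k (y - 1)).toReal +
            (halfPlaneGreen r (k - 1) y).toReal) := by
      funext k
      rw [halfPlaneGreen_eq r k hy, ENNReal.toReal_add, ENNReal.toReal_mul, toReal_mul_three_inv,
        ENNReal.toReal_add, ENNReal.toReal_add (hBne _ _) (hBne _ _)]
      · congr 1
        split_ifs <;> simp_all
      · exact ENNReal.add_ne_top.2 ⟨hBne _ _, hBne _ _⟩
      · exact hBne _ _
      · split_ifs <;> simp
      · exact ENNReal.mul_ne_top (ENNReal.mul_ne_top hr.ne_top (by norm_num))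
          (ENNReal.add_ne_top.2 ⟨ENNReal.add_ne_top.2 ⟨hBne _ _, hBne _ _⟩, hBne _ _⟩)
    have e2 : Summable fun k : ℤ => (if k = 0 then (if y = 1 then 1 else 0) else (0 : ℝ)) :=
      (summable_int_single _)
    change fourierSum (fun k => (halfPlaneGreen r k y).toReal) θ = _
    rw [e1, fourierSum_add e2 ((((hBsum _).add (hBsum _)).add (hBs1 _)).mul_left _),
      fourierSum_single, fourierSum_const_mul, fourierSum_add ((hBsum _).add (hBsum _)) (hBs1 _),
      fourierSum_add (hBsum _) (hBsum _), fourierSum_shift (fun k => (halfPlaneGreen r k y).toReal)]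
    push_cast
    split_ifs <;> simp [b]
  have hbb : ∀ y, ‖b y‖ ≤ (1 - r)⁻¹.toReal := by
    intro y
    refine (norm_fourierSum_le (hBsum y) (fun _ => ENNReal.toReal_nonneg) θ).trans ?_
    rw [← ENNReal.tsum_toReal_eq (fun k => hBne k y)]
    exact ENNReal.toReal_mono (inv_one_sub_ne_top hr) (tsum_halfPlaneGreen_le r y)
  have hrc : (r.toReal : ℂ) ≠ 0 := by exact_mod_cast hrr.ne'
  -- Replacing the boundary value `b 0 = 0` by `3 / r` absorbs the unit source at height one, so the
  -- recursion becomes homogeneous from `n = 0` on. The transform of the return law, `r / 3 * b 1`,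
  -- is then `c 1 / c 0`.
  let c : ℕ → ℂ := fun n => if n = 0 then 3 / r.toReal else b n
  have hrec : ∀ n, c (n + 2) = (3 / r.toReal - Complex.exp (θ * Complex.I)) * c (n + 1) - c n := by
    intro n
    have h1 := hb (n + 1) (by omega)
    rw [add_sub_cancel_right, show ((n : ℤ) + 1 + 1) = n + 2 by ring] at h1
    simp only [c, Nat.add_eq_zero_iff, OfNat.ofNat_ne_zero, one_ne_zero, and_false, if_false]
    push_cast
    rcases Nat.eq_zero_or_pos n with rfl | hn
    · simp only [Nat.cast_zero, zero_add, hb0, if_true, add_zero] at h1 ⊢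
      field_simp
      linear_combination (-3 : ℂ) * h1
    · rw [if_neg (by omega)] at h1
      rw [if_neg hn.ne']
      field_simp
      linear_combination (-3 : ℂ) * h1
  have hcb : ∀ n, ‖c n‖ ≤ 3 / r.toReal + (1 - r)⁻¹.toReal := by
    intro n
    have h1 : 0 ≤ (1 - r)⁻¹.toReal := ENNReal.toReal_nonneg
    have h2 : 0 ≤ 3 / r.toReal := by positivity
    by_cases hn : n = 0
    · simp only [c, hn, if_true, norm_div, Complex.norm_real, Real.norm_of_nonneg hrr.le]
      simp
    · simp only [c, hn, if_false]
      linarith [hbb n]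
  have hκ : 2 < (3 / r.toReal - Complex.exp (θ * Complex.I) : ℂ).re := by
    have h1 : (3 / r.toReal : ℂ) = ((3 / r.toReal : ℝ) : ℂ) := by push_cast; rfl
    rw [h1, Complex.sub_re, Complex.ofReal_re, Complex.exp_ofReal_mul_I_re]
    have h2 : 3 < 3 / r.toReal := by rw [lt_div_iff₀ hrr]; linarith
    linarith [Real.cos_le_one θ]
  obtain ⟨l, hl1, hl2, hl3⟩ := exists_root_of_bounded_recursion hκ hcb hrec
  have hl : fourierSum (fun k => (returnLaw r k).toReal) θ = l := by
    have e1 : (fun k => (returnLaw r k).toReal) =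
        fun k => r.toReal / 3 * (halfPlaneGreen r k 1).toReal := by
      funext k
      rw [returnLaw, ENNReal.toReal_mul, toReal_mul_three_inv]
    rw [e1, fourierSum_const_mul]
    simp only [c, one_ne_zero, if_false, if_true, Nat.cast_one] at hl3
    have : fourierSum (fun k => (halfPlaneGreen r k 1).toReal) θ = b 1 := rfl
    rw [this, hl3]
    push_cast
    field_simp
  rw [hl]
  exact ⟨hl1, hl2⟩

/-! ### Renewal equations in Fourier space -/

section Spectral

variable {Ω : Type*} [MeasurableSpace Ω] {μ : Measure Ω} [IsProbabilityMeasure μ]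
  {M : ℕ → Ω → ℤ × ℤ} {r : ℝ≥0∞}

theorem tsum_hitGreen_ne_top (h : IsSimpleRandomWalk graphG1 (0, 0) μ M) (hr : r < 1) :
    ∑' m, hitGreen μ M r m ≠ ⊤ :=
  ne_top_of_le_ne_top (inv_one_sub_ne_top hr) (tsum_hitGreen_le h)

theorem tsum_exitGreen_ne_top (h : IsSimpleRandomWalk graphG1 (0, 0) μ M) (hr : r < 1) :
    ∑' e, exitGreen μ M r e ≠ ⊤ := by
  unfold exitGreen
  rw [ENNReal.tsum_comm]
  have : ∀ m, ∑' e, hitGreen μ M r m * axisLaw (r * 3⁻¹) (e - m) =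
      hitGreen μ M r m * ∑' j, axisLaw (r * 3⁻¹) j := by
    intro m
    rw [ENNReal.tsum_mul_left]
    congr 1
    exact (Equiv.subRight m).tsum_eq fun j => axisLaw (r * 3⁻¹) j
  simp_rw [this]
  rw [ENNReal.tsum_mul_right]
  exact ENNReal.mul_ne_top (tsum_hitGreen_ne_top h hr) (tsum_axisLaw_ne_top hr)

theorem toReal_exitGreen (h : IsSimpleRandomWalk graphG1 (0, 0) μ M) (hr : r < 1) (e : ℤ) :
    (exitGreen μ M r e).toReal =
      ∑' m, (hitGreen μ M r m).toReal * (axisLaw (r * 3⁻¹) (e - m)).toReal := by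
  rw [exitGreen, ENNReal.tsum_toReal_eq]
  · simp_rw [ENNReal.toReal_mul]
  · exact ENNReal.ne_top_of_tsum_ne_top
      (ENNReal.ne_top_of_tsum_ne_top (tsum_exitGreen_ne_top h hr) e)

theorem summable_conv_toReal {f g : ℤ → ℝ≥0∞} (hf : ∑' n, f n ≠ ⊤) (hg : ∑' n, g n ≠ ⊤) (d : ℤ → ℤ) :
    Summable fun e => (f e).toReal * (g (d e)).toReal := by
  simp_rw [← ENNReal.toReal_mul]
  refine ENNReal.summable_toReal (ne_top_of_le_ne_top (ENNReal.mul_ne_top hf hg) ?_)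
  rw [← ENNReal.tsum_mul_right]
  exact ENNReal.tsum_le_tsum fun e => mul_le_mul_right (ENNReal.le_tsum _) _

theorem toReal_hitGreen (h : IsSimpleRandomWalk graphG1 (0, 0) μ M) (hr : r < 1) (m : ℤ) :
    (hitGreen μ M r m).toReal = (if m = 0 then 1 else 0) +
      (∑' e, (exitGreen μ M r e).toReal * (returnLaw r (m - e)).toReal +
        ∑' e, (exitGreen μ M r e).toReal * (returnLaw r (-(m - e))).toReal) := by
  have hK := tsum_exitGreen_ne_top h hr
  have hR := tsum_returnLaw_ne_top hr
  have hne : ∀ e, exitGreen μ M r e * (returnLaw r (m - e) + returnLaw r (e - m)) ≠ ⊤ := fun e =>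
    ENNReal.mul_ne_top (ENNReal.ne_top_of_tsum_ne_top hK e) (ENNReal.add_ne_top.2
      ⟨ENNReal.ne_top_of_tsum_ne_top hR _, ENNReal.ne_top_of_tsum_ne_top hR _⟩)
  have hT := ENNReal.ne_top_of_tsum_ne_top (tsum_hitGreen_ne_top h hr) m
  have heq := hitGreen_eq h hr m
  have hT2 : ∑' e, exitGreen μ M r e * (returnLaw r (m - e) + returnLaw r (e - m)) ≠ ⊤ := by
    refine ne_top_of_le_ne_top hT ?_
    rw [heq]
    exact le_add_self
  rw [heq, ENNReal.toReal_add (by split_ifs <;> simp) hT2, ENNReal.tsum_toReal_eq hne,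
    ← (summable_conv_toReal hK hR _).tsum_add (summable_conv_toReal hK hR _)]
  congr 1
  · split_ifs <;> simp
  · refine tsum_congr fun e => ?_
    rw [ENNReal.toReal_mul, ENNReal.toReal_add (ENNReal.ne_top_of_tsum_ne_top hR _)
      (ENNReal.ne_top_of_tsum_ne_top hR _), neg_sub, mul_add]

/-- Transform of the geometric recursion `axisLaw_eq`, stated without division. -/
theorem fourierSum_axisLaw (hr : r < 1) (θ : ℝ) :
    fourierSum (fun j => (axisLaw (r * 3⁻¹) j).toReal) θ *
      (1 - r.toReal / 3 * Complex.exp (θ * Complex.I)) = r.toReal / 3 := by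
  have hA := tsum_axisLaw_ne_top hr
  have hs := ENNReal.summable_toReal hA
  have hs1 : Summable fun j : ℤ => (axisLaw (r * 3⁻¹) (j - 1)).toReal :=
    summable_int_shift (fun j => (axisLaw (r * 3⁻¹) j).toReal) hs
  have hq : r * 3⁻¹ ≠ ⊤ := ENNReal.mul_ne_top hr.ne_top (by norm_num)
  have e1 : (fun j => (axisLaw (r * 3⁻¹) j).toReal) = fun j : ℤ =>
      (if j = 0 then r.toReal / 3 else 0) + r.toReal / 3 * (axisLaw (r * 3⁻¹) (j - 1)).toReal := by
    funext j
    rw [axisLaw_eq, ENNReal.toReal_add (by split_ifs <;> simp [hq])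
      (ENNReal.mul_ne_top hq (ENNReal.ne_top_of_tsum_ne_top hA _)), ENNReal.toReal_mul,
      toReal_mul_three_inv]
    congr 1
    split_ifs
    · exact toReal_mul_three_inv r
    · simp
  have e2 : fourierSum (fun j => (axisLaw (r * 3⁻¹) j).toReal) θ = r.toReal / 3 + r.toReal / 3 *
      (Complex.exp (θ * Complex.I) * fourierSum (fun j => (axisLaw (r * 3⁻¹) j).toReal) θ) := by
    conv_lhs => rw [e1]
    rw [fourierSum_add (summable_int_single _) (hs1.mul_left _), fourierSum_single,
      fourierSum_const_mul, fourierSum_shift fun j => (axisLaw (r * 3⁻¹) j).toReal]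
    push_cast
    rfl
  linear_combination e2

/-- Fourier transforms of the Green functions of the hits of the axis and of the departures from
it, in terms of the characteristic function of the return law. -/
theorem fourierSum_green (h : IsSimpleRandomWalk graphG1 (0, 0) μ M) (hr0 : r ≠ 0) (hr : r < 1)
    (θ : ℝ) {l : ℂ} (hl : fourierSum (fun k => (returnLaw r k).toReal) θ = l) :
    fourierSum (fun m => (hitGreen μ M r m).toReal) θ * (1 - Complex.normSq l) = 1 + l ^ 2 ∧
    fourierSum (fun e => (exitGreen μ M r e).toReal) θ * (1 - Complex.normSq l) = l := by
  obtain ⟨-, hl2⟩ := fourierSum_returnLaw hr0 hr θ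
  have hax := fourierSum_axisLaw hr θ
  rw [hl] at hl2
  have hl0 : l ≠ 0 := by rintro rfl; simp at hl2
  have hrc : (r.toReal : ℂ) ≠ 0 := by exact_mod_cast (ENNReal.toReal_pos hr0 hr.ne_top).ne'
  have hsG := ENNReal.summable_toReal (tsum_hitGreen_ne_top h hr)
  have hsK := ENNReal.summable_toReal (tsum_exitGreen_ne_top h hr)
  have hsR := ENNReal.summable_toReal (tsum_returnLaw_ne_top hr)
  have hsR' : Summable fun k => (returnLaw r (-k)).toReal := summable_int_neg (fun k => (returnLaw r k).toReal) hsR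
  have hsA := ENNReal.summable_toReal (tsum_axisLaw_ne_top hr)
  have hconv : ∀ {f g : ℤ → ℝ}, Summable f → Summable g →
      Summable fun n => ∑' m, f m * g (n - m) := by
    intro f g hf hg
    have hs := summable_mul_of_summable_norm hf.norm hg.norm
    let E : ℤ × ℤ ≃ ℤ × ℤ :=
      { toFun := fun p => (p.2, p.1 - p.2)
        invFun := fun p => (p.1 + p.2, p.1)
        left_inv := fun p => by simp
        right_inv := fun p => by simp }
    exact (E.summable_iff.2 hs).prod
  have eK : fourierSum (fun e => (exitGreen μ M r e).toReal) θ =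
      fourierSum (fun m => (hitGreen μ M r m).toReal) θ *
        fourierSum (fun j => (axisLaw (r * 3⁻¹) j).toReal) θ := by
    rw [← fourierSum_conv hsG hsA]
    congr 1
    funext e
    exact toReal_exitGreen h hr e
  have eG : fourierSum (fun m => (hitGreen μ M r m).toReal) θ =
      1 + fourierSum (fun e => (exitGreen μ M r e).toReal) θ * (l + (starRingEnd ℂ) l) := by
    have h1 := fourierSum_conv hsK hsR θ
    have h2 := fourierSum_conv hsK hsR' θ
    rw [fourierSum_neg (fun k => (returnLaw r k).toReal)] at h2
    rw [hl] at h1 h2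
    rw [mul_add, ← h1, ← h2, ← fourierSum_add (hconv hsK hsR) (hconv hsK hsR')]
    have h3 := fourierSum_single 1 θ
    rw [Complex.ofReal_one] at h3
    rw [← h3, ← fourierSum_add (summable_int_single _)
      ((hconv hsK hsR).add (hconv hsK hsR'))]
    congr 1
    funext m
    exact toReal_hitGreen h hr m
  set Gf := fourierSum (fun m => (hitGreen μ M r m).toReal) θ
  set Kf := fourierSum (fun e => (exitGreen μ M r e).toReal) θ
  set Af := fourierSum (fun j => (axisLaw (r * 3⁻¹) j).toReal) θ
  -- The transform of the axis law is the inverse of `3 / r - exp(iθ)`, that is `l / (1 + l²)` by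
  -- the quadratic equation.
  have hKG : Kf * (l ^ 2 + 1) = Gf * l := by
    rw [eK, hl2]
    have : (3 / r.toReal - Complex.exp (θ * Complex.I) : ℂ) =
        3 / r.toReal * (1 - r.toReal / 3 * Complex.exp (θ * Complex.I)) := by
      field_simp
    rw [this]
    have h3 : (3 / r.toReal : ℂ) * (r.toReal / 3) = 1 := by field_simp
    linear_combination (Gf * l * (3 / r.toReal)) * hax + Gf * l * h3
  -- Inserting the renewal equation for `Gf` cancels `Kf * l²` and leaves `Kf * (1 - l * conj l) =
  -- l`.
  have hK : Kf * (1 - Complex.normSq l) = l := by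
    rw [← Complex.mul_conj]
    linear_combination hKG + l * eG
  refine ⟨?_, hK⟩
  apply mul_right_cancel₀ hl0
  linear_combination (1 + l ^ 2) * hK - (1 - (Complex.normSq l : ℂ)) * hKG

end Spectral

/-! ### Dirichlet kernels and sums over symmetric windows -/

/-- The Dirichlet kernel `∑_{|e| < k} cos (e θ)`. -/
noncomputable def dirichletSum (k : ℕ) (θ : ℝ) : ℝ :=
  ∑ j ∈ Finset.range k, if j = 0 then 1 else 2 * Real.cos (j * θ)

theorem continuous_dirichletSum (k : ℕ) : Continuous (dirichletSum k) := by
  unfold dirichletSum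
  refine continuous_finsetSum _ fun j _ => ?_
  split_ifs <;> fun_prop

theorem abs_dirichletSum_le (k : ℕ) (θ : ℝ) : |dirichletSum k θ| ≤ 2 * k := by
  unfold dirichletSum
  refine (Finset.abs_sum_le_sum_abs _ _).trans ?_
  refine (Finset.sum_le_card_nsmul _ _ 2 fun j _ => ?_).trans_eq (by simp [mul_comm])
  split_ifs
  · norm_num
  · rw [abs_mul, abs_two]
    linarith [Real.abs_cos_le_one (j * θ)]

/-- This is the closed form `cot(θ/2) sin(kθ) - cos(kθ)` cleared of its denominator. The empty
kernel `k = 0` needs the correction term. -/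
theorem one_sub_cos_mul_dirichletSum (k : ℕ) (θ : ℝ) :
    (1 - Real.cos θ) * dirichletSum k θ = Real.sin θ * Real.sin (k * θ) -
      (1 - Real.cos θ) * (Real.cos (k * θ) - if k = 0 then 1 else 0) := by
  cases k with
  | zero => simp [dirichletSum]
  | succ k =>
    induction k with
    | zero =>
      simp [dirichletSum]
      nlinarith [Real.sin_sq_add_cos_sq θ]
    | succ k ih =>
      unfold dirichletSum at ih ⊢
      rw [Finset.sum_range_succ, mul_add, ih]
      have e : ((k + 1 + 1 : ℕ) : ℝ) * θ = (k + 1 : ℕ) * θ + θ := by push_cast; ring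
      rw [e, Real.sin_add, Real.cos_add]
      simp only [Nat.add_eq_zero_iff, one_ne_zero, and_false, if_false]
      linear_combination (-Real.cos ((k + 1 : ℕ) * θ)) * Real.sin_sq_add_cos_sq θ

/-- The mass that a sequence gives to `{e | |e| < k}`. -/
noncomputable def windowSum (f : ℤ → ℝ) (k : ℕ) : ℝ := ∑' e : ℤ, if |e| < k then f e else 0

theorem windowSum_zero (f : ℤ → ℝ) : windowSum f 0 = 0 := by
  have : ∀ e : ℤ, ¬ |e| < 0 := fun e => not_lt.2 (abs_nonneg e)
  simp [windowSum, this]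

theorem windowSum_succ {f : ℤ → ℝ} (hf : Summable f) (k : ℕ) :
    windowSum f (k + 1) = windowSum f k + if k = 0 then f 0 else f k + f (-k) := by
  have hs : ∀ j : ℕ, Summable fun e : ℤ => if |e| < j then f e else 0 := fun j =>
    Summable.of_norm_bounded hf.norm fun e => by split_ifs <;> simp
  have h1 : ∀ a b : ℤ, HasSum (fun e : ℤ => if e = a then f b else 0) (f b) := fun a b =>
    hasSum_ite_eq a (f b)
  unfold windowSum
  split_ifs with hk
  · subst hk
    rw [← (h1 0 0).tsum_eq, ← (hs 0).tsum_add (h1 0 0).summable]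
    refine tsum_congr fun e => ?_
    by_cases he : e = 0
    · simp [he]
    · have : ¬ |e| < 1 := by rw [Int.abs_lt_one_iff]; exact he
      have h2 : ¬ |e| < 0 := not_lt.2 (abs_nonneg e)
      simp [he, this, h2]
  · rw [← (h1 k k).tsum_eq, ← (h1 (-k) (-k)).tsum_eq,
      ← (h1 k k).summable.tsum_add (h1 (-k) (-k)).summable,
      ← (hs k).tsum_add ((h1 k k).summable.add (h1 (-k) (-k)).summable)]
    refine tsum_congr fun e => ?_
    have hk' : 0 < k := Nat.pos_of_ne_zero hk
    rcases lt_trichotomy |e| (k : ℤ) with h | h | h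
    · have h2 : |e| < ((k + 1 : ℕ) : ℤ) := by push_cast; omega
      have h3 : e ≠ k := by rintro rfl; simp at h
      have h4 : e ≠ -k := by rintro rfl; simp at h
      simp only [h, h2, h3, h4, if_true, if_false, add_zero]
    · have h2 : |e| < ((k + 1 : ℕ) : ℤ) := by push_cast; omega
      rw [if_pos h2, if_neg (by omega)]
      rcases (abs_eq (by omega)).1 h with rfl | rfl
      · rw [if_pos rfl, if_neg (by omega)]; ring
      · rw [if_pos rfl, if_neg (by omega)]; ring
    · have h2 : ¬ |e| < ((k + 1 : ℕ) : ℤ) := by push_cast; omega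
      have h3 : e ≠ k := by rintro rfl; simp at h
      have h4 : e ≠ -k := by rintro rfl; simp at h
      have h5 : ¬ |e| < k := not_lt.2 h.le
      simp only [h2, h3, h4, h5, if_false, add_zero]

/-- Fourier inversion term by term: `2 cos(jθ)` is the sum of two exponentials, which extract the
coefficients at `j` and `-j`. -/
theorem integral_fourierSum_mul_dirichletSum {f : ℤ → ℝ} (hf : Summable f) (k : ℕ) :
    ∫ θ in (-Real.pi)..Real.pi, fourierSum f θ * dirichletSum k θ =
      2 * Real.pi * windowSum f k := by
  have hc := continuous_fourierSum hf
  induction k with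
  | zero => simp [dirichletSum, windowSum_zero]
  | succ k ih =>
    rw [windowSum_succ hf]
    have e1 : ∀ θ : ℝ, fourierSum f θ * dirichletSum (k + 1) θ = fourierSum f θ * dirichletSum k θ +
        fourierSum f θ * ((if k = 0 then 1 else 2 * Real.cos (k * θ) : ℝ) : ℂ) := by
      intro θ
      rw [dirichletSum, Finset.sum_range_succ, ← dirichletSum]
      push_cast
      ring
    have hi1 : IntervalIntegrable (fun θ : ℝ => fourierSum f θ * dirichletSum k θ) volume
        (-Real.pi) Real.pi :=
      (hc.mul (Complex.continuous_ofReal.comp (continuous_dirichletSum k))).intervalIntegrable _ _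
    simp_rw [e1]
    split_ifs with hk
    · rw [intervalIntegral.integral_add hi1 (by
        simpa using hc.intervalIntegrable _ _), ih]
      have := integral_fourierSum_mul hf 0
      simp only [Int.cast_zero, zero_mul, neg_zero, Complex.exp_zero, mul_one] at this
      simp only [Complex.ofReal_one, mul_one, this]
      push_cast
      ring
    · have e2 : ∀ θ : ℝ, fourierSum f θ * ((2 * Real.cos (k * θ) : ℝ) : ℂ) =
          fourierSum f θ * Complex.exp (-((k : ℤ) * θ * Complex.I)) +
          fourierSum f θ * Complex.exp (-((-k : ℤ) * θ * Complex.I)) := by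
        intro θ
        push_cast
        rw [Complex.two_cos, ← mul_add]
        congr 1
        rw [add_comm]
        congr 2 <;> ring
      have hi2 : ∀ m : ℤ, IntervalIntegrable (fun θ : ℝ => fourierSum f θ *
          Complex.exp (-(m * θ * Complex.I))) volume (-Real.pi) Real.pi := fun m =>
        (hc.mul (by fun_prop)).intervalIntegrable _ _
      simp_rw [e2]
      rw [intervalIntegral.integral_add hi1 ((hi2 _).add (hi2 _)),
        intervalIntegral.integral_add (hi2 _) (hi2 _), ih, integral_fourierSum_mul hf,
        integral_fourierSum_mul hf]
      push_cast
      ring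

/-- Integral representation of `∑ₖ g(k) ∑_{|e| < k} f(e)`. -/
theorem hasSum_mul_windowSum {f : ℤ → ℝ} (hf : Summable f) {g : ℕ → ℝ} (hg0 : ∀ k, 0 ≤ g k)
    (hg : Summable fun k : ℕ => (k : ℝ) * g k) :
    HasSum (fun k => g k * windowSum f k) ((2 * Real.pi)⁻¹ *
      ∫ θ in (-Real.pi)..Real.pi, (fourierSum f θ).re * ∑' k, g k * dirichletSum k θ) := by
  have hc := continuous_fourierSum hf
  have hsum : ∀ θ, Summable fun k => g k * dirichletSum k θ := fun θ =>
    Summable.of_norm_bounded (hg.mul_left 2) fun k => by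
      rw [Real.norm_eq_abs, abs_mul, abs_of_nonneg (hg0 k)]
      nlinarith [abs_dirichletSum_le k θ, hg0 k]
  have h := intervalIntegral.hasSum_integral_of_dominated_convergence (μ := volume)
    (a := -Real.pi) (b := Real.pi)
    (F := fun (k : ℕ) (θ : ℝ) => (fourierSum f θ).re * (g k * dirichletSum k θ))
    (f := fun θ => (fourierSum f θ).re * ∑' k, g k * dirichletSum k θ)
    (fun k _ => (∑' n, |f n|) * (2 * (k * g k)))
    (fun k => ((Complex.continuous_re.comp hc).mul
      (continuous_const.mul (continuous_dirichletSum k))).aestronglyMeasurable)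
    (fun k => Eventually.of_forall fun θ _ => ?_)
    (Eventually.of_forall fun θ _ => (hg.mul_left 2).mul_left _)
    (by simp) (Eventually.of_forall fun θ _ => (hsum θ).hasSum.mul_left _)
  · have h2 := h.mul_left (2 * Real.pi)⁻¹
    refine h2.congr_fun fun k => ?_
    have h3 := congrArg Complex.re (integral_fourierSum_mul_dirichletSum hf k)
    have h4 : (∫ θ in (-Real.pi)..Real.pi, fourierSum f θ * dirichletSum k θ).re =
        ∫ θ in (-Real.pi)..Real.pi, (fourierSum f θ).re * dirichletSum k θ := by
      have hi : IntervalIntegrable (fun θ : ℝ => fourierSum f θ * dirichletSum k θ) volume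
        (-Real.pi) Real.pi :=
        (hc.mul (Complex.continuous_ofReal.comp (continuous_dirichletSum k))).intervalIntegrable _ _
      have := Complex.reCLM.intervalIntegral_comp_comm hi
      simp only [Complex.reCLM_apply, Complex.re_mul_ofReal] at this
      exact this.symm
    have h5 : (2 * (Real.pi : ℂ) * (windowSum f k : ℂ)).re = 2 * Real.pi * windowSum f k := by
      rw [← Complex.ofReal_ofNat, ← Complex.ofReal_mul, ← Complex.ofReal_mul, Complex.ofReal_re]
    rw [h4, h5] at h3
    have h6 : ∀ θ, (fourierSum f θ).re * (g k * dirichletSum k θ) =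
        g k * ((fourierSum f θ).re * dirichletSum k θ) := fun θ => by ring
    simp_rw [h6]
    rw [intervalIntegral.integral_const_mul, h3]
    field_simp
  · rw [norm_mul, Real.norm_eq_abs, Real.norm_eq_abs, abs_mul, abs_of_nonneg (hg0 k)]
    refine mul_le_mul ?_ ?_ (by have := hg0 k; positivity) (tsum_nonneg fun _ => abs_nonneg _)
    · refine (Complex.abs_re_le_norm _).trans ?_
      refine (norm_tsum_le_tsum_norm (summable_norm_fourierSum hf θ)).trans_eq
        (tsum_congr fun n => ?_)
      rw [norm_mul, norm_exp_int_mul, mul_one, Complex.norm_real, Real.norm_eq_abs]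
    · nlinarith [abs_dirichletSum_le k θ, hg0 k]

theorem continuous_tsum_mul_dirichletSum {g : ℕ → ℝ} (hg0 : ∀ k, 0 ≤ g k)
    (hg : Summable fun k : ℕ => (k : ℝ) * g k) :
    Continuous fun θ => ∑' k, g k * dirichletSum k θ := by
  refine continuous_tsum (u := fun k => 2 * (k * g k))
    (fun k => continuous_const.mul (continuous_dirichletSum k)) (hg.mul_left 2) fun k θ => ?_
  rw [Real.norm_eq_abs, abs_mul, abs_of_nonneg (hg0 k)]
  nlinarith [abs_dirichletSum_le k θ, hg0 k]

theorem fourierSum_of_nonneg_support {f : ℤ → ℝ} (hf0 : ∀ k < 0, f k = 0)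
    (θ : ℝ) : fourierSum f θ = ∑' k : ℕ, (f k : ℂ) * Complex.exp (k * θ * Complex.I) := by
  unfold fourierSum
  rw [← (Nat.cast_injective (R := ℤ)).tsum_eq]
  · simp
  · intro j hj
    have : 0 ≤ j := by
      by_contra hc
      exact hj (by simp [hf0 j (not_le.1 hc)])
    exact ⟨j.toNat, by simp [this]⟩

/-- Summing the closed form of the Dirichlet kernels against `f` produces the real and imaginary
parts of its transform; the correction at `k = 0` is the term `f 0`. Thus the kernel sum becomes a
function of the single number `l`. -/
theorem one_sub_cos_mul_tsum {f : ℤ → ℝ} (hf : Summable f) (hf0 : ∀ k < 0, f k = 0)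
    (θ : ℝ) :
    (1 - Real.cos θ) * ∑' k : ℕ, f k * dirichletSum k θ =
      Real.sin θ * (fourierSum f θ).im - (1 - Real.cos θ) * ((fourierSum f θ).re - f 0) := by
  have hs : Summable fun k : ℕ => (f k : ℂ) * Complex.exp (k * θ * Complex.I) := by
    have := (summable_fourierSum hf θ).comp_injective (Nat.cast_injective (R := ℤ))
    simpa [Function.comp_def] using this
  have hexp : ∀ k : ℕ, (k * θ : ℂ) = ((k * θ : ℝ) : ℂ) := fun k => by push_cast; rfl
  have hre : HasSum (fun k : ℕ => f k * Real.cos (k * θ)) (fourierSum f θ).re := by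
    rw [fourierSum_of_nonneg_support hf0]
    have := Complex.reCLM.hasSum hs.hasSum
    simpa only [Function.comp_def, Complex.reCLM_apply, hexp, Complex.re_ofReal_mul,
      Complex.exp_ofReal_mul_I_re] using this
  have him : HasSum (fun k : ℕ => f k * Real.sin (k * θ)) (fourierSum f θ).im := by
    rw [fourierSum_of_nonneg_support hf0]
    have := Complex.imCLM.hasSum hs.hasSum
    simpa only [Function.comp_def, Complex.imCLM_apply, hexp, Complex.im_ofReal_mul,
      Complex.exp_ofReal_mul_I_im] using this
  have h0 : HasSum (fun k : ℕ => if k = 0 then f 0 else 0) (f 0) := hasSum_ite_eq 0 _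
  rw [← tsum_mul_left]
  refine HasSum.tsum_eq ?_
  have := (him.mul_left (Real.sin θ)).sub ((hre.sub h0).mul_left (1 - Real.cos θ))
  refine this.congr_fun fun k => ?_
  rw [mul_left_comm, one_sub_cos_mul_dirichletSum]
  rcases Nat.eq_zero_or_pos k with rfl | hk
  · simp
  · simp [hk.ne']; ring

/-! ### Elementary trigonometric inequalities -/

theorem abs_sin_eq_sin_abs {θ : ℝ} (hθ : |θ| ≤ Real.pi) : |Real.sin θ| = Real.sin |θ| :=
  Real.abs_sin_eq_sin_abs_of_abs_le_pi hθ

/-- Up to `π/2` Jordan's inequality suffices; beyond it `sin - cos ≥ 1`, so the right side is at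
least `4 ≥ π`. -/
theorem abs_le_two_mul_abs_sin_add {θ : ℝ} (hθ : |θ| ≤ Real.pi) :
    |θ| ≤ 2 * |Real.sin θ| + 2 * (1 - Real.cos θ) := by
  rw [abs_sin_eq_sin_abs hθ, ← Real.cos_abs]
  have h0 := abs_nonneg θ
  generalize |θ| = t at *
  have hs := Real.sin_nonneg_of_nonneg_of_le_pi h0 hθ
  have hsc := Real.sin_sq_add_cos_sq t
  have hpi := Real.pi_le_four
  rcases le_total t (Real.pi / 2) with h | h
  · have h1 := Real.mul_le_sin h0 h
    have h2 : t / 2 ≤ 2 / Real.pi * t := by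
      rw [div_mul_eq_mul_div, div_le_div_iff₀ two_pos Real.pi_pos]
      nlinarith
    linarith [Real.cos_le_one t]
  · have hc : Real.cos t ≤ 0 := Real.cos_nonpos_of_pi_div_two_le_of_le h (by linarith)
    have h1 : 1 ≤ Real.sin t - Real.cos t := by nlinarith
    linarith

/-- In terms of the half angle `u` this is `u * cos u ≤ sin u`, that is, `u ≤ tan u`. -/
theorem abs_mul_one_add_cos_le {θ : ℝ} (hθ : |θ| ≤ Real.pi) :
    |θ| * (1 + Real.cos θ) ≤ 2 * |Real.sin θ| := by
  rw [abs_sin_eq_sin_abs hθ, ← Real.cos_abs]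
  have h0 := abs_nonneg θ
  generalize |θ| = t at *
  obtain ⟨u, rfl⟩ : ∃ u, t = 2 * u := ⟨t / 2, by ring⟩
  rw [Real.cos_two_mul, Real.sin_two_mul]
  have hu : 0 ≤ u := by linarith
  have hc : 0 ≤ Real.cos u := Real.cos_nonneg_of_neg_pi_div_two_le_of_le (by linarith [Real.pi_pos])
    (by linarith)
  have h1 : u * Real.cos u ≤ Real.sin u := by
    rcases eq_or_lt_of_le (show u ≤ Real.pi / 2 by linarith) with h | h
    · rw [h]; simp
    · have h2 := Real.le_tan hu h
      have h3 : 0 < Real.cos u := Real.cos_pos_of_mem_Ioo ⟨by linarith [Real.pi_pos], h⟩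
      rwa [Real.tan_eq_sin_div_cos, le_div_iff₀ h3] at h2
  nlinarith

/-! ### Estimates for the small root -/

/-- `l` is the small root of the characteristic equation with parameters `r` and `θ`. -/
structure IsSmallRoot (r θ : ℝ) (l : ℂ) : Prop where
  pos : 0 < r
  lt_one : r < 1
  norm_lt : ‖l‖ < 1
  eq : l ^ 2 + 1 = (3 / r - Complex.exp (θ * Complex.I)) * l

/-- The quantity `(|l|⁻¹ - |l|)²`. -/
noncomputable def gapSq (l : ℂ) : ℝ := (1 - Complex.normSq l) ^ 2 / Complex.normSq l

namespace IsSmallRoot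

variable {r θ : ℝ} {l : ℂ}

theorem normSq_pos (h : IsSmallRoot r θ l) : 0 < Complex.normSq l := by
  rw [Complex.normSq_pos]
  rintro rfl
  have := h.eq
  simp at this

theorem normSq_lt_one (h : IsSmallRoot r θ l) : Complex.normSq l < 1 := by
  rw [Complex.normSq_eq_norm_sq]
  have := h.norm_lt
  nlinarith [norm_nonneg l]

/-- Multiplying the equation by `conj l` turns `l + 1/l` into a combination of `l` and `conj l` with
real coefficients, so real and imaginary parts separate. -/
theorem re_im (h : IsSmallRoot r θ l) :
    l.re * (1 + Complex.normSq l) = Complex.normSq l * (3 / r - Real.cos θ) ∧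
    l.im * (1 - Complex.normSq l) = Complex.normSq l * Real.sin θ := by
  have h1 : l * Complex.normSq l + (starRingEnd ℂ) l =
      (((3 / r : ℝ) : ℂ) - Complex.exp (θ * Complex.I)) * Complex.normSq l := by
    rw [← Complex.mul_conj]
    push_cast
    linear_combination (starRingEnd ℂ) l * h.eq
  have hre := congrArg Complex.re h1
  have him := congrArg Complex.im h1
  simp only [Complex.add_re, Complex.add_im, Complex.re_mul_ofReal, Complex.im_mul_ofReal,
    Complex.conj_re, Complex.conj_im, Complex.sub_re, Complex.sub_im, Complex.ofReal_re,
    Complex.ofReal_im, Complex.exp_ofReal_mul_I_re, Complex.exp_ofReal_mul_I_im] at hre him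
  constructor <;> linarith

theorem gapSq_pos (h : IsSmallRoot r θ l) : 0 < gapSq l := by
  have h1 := h.normSq_pos
  have h2 := h.normSq_lt_one
  have h3 : 0 < 1 - Complex.normSq l := by linarith
  unfold gapSq
  positivity

theorem gapSq_mul (h : IsSmallRoot r θ l) :
    gapSq l * Complex.normSq l = (1 - Complex.normSq l) ^ 2 := by
  have h1 := h.normSq_pos
  unfold gapSq
  field_simp

theorem sqrt_mul_sqrt_gapSq (h : IsSmallRoot r θ l) :
    √(Complex.normSq l) * √(gapSq l) = 1 - Complex.normSq l := by
  rw [← Real.sqrt_mul h.normSq_pos.le, mul_comm, h.gapSq_mul, Real.sqrt_sq]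
  linarith [h.normSq_lt_one]

/-- Eliminating `l.re` and `l.im` from `re_im` through `l.re² + l.im² = |l|²` leaves an equation in
`|l|²` alone, which is quadratic in the gap square. The bracket contains `|3/r - exp(iθ)|² - 4`,
called `b` below. -/
theorem gapSq_quadratic (h : IsSmallRoot r θ l) :
    gapSq l * (gapSq l - ((3 / r - Real.cos θ) ^ 2 + Real.sin θ ^ 2 - 4)) =
      4 * Real.sin θ ^ 2 := by
  obtain ⟨h1, h2⟩ := h.re_im
  have h3 : l.re ^ 2 + l.im ^ 2 = Complex.normSq l := by rw [Complex.normSq_apply]; ring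
  have hN := h.normSq_pos
  have hN1 := h.normSq_lt_one
  have hv := h.gapSq_mul
  set N := Complex.normSq l
  set v := gapSq l
  have h4 : N * ((3 / r - Real.cos θ) ^ 2 * (1 - N) ^ 2 + Real.sin θ ^ 2 * (1 + N) ^ 2) =
      (1 - N) ^ 2 * (1 + N) ^ 2 := by
    have h5 : (l.re * (1 + N)) ^ 2 * (1 - N) ^ 2 + (l.im * (1 - N)) ^ 2 * (1 + N) ^ 2 =
        N * ((1 - N) ^ 2 * (1 + N) ^ 2) := by
      linear_combination (1 + N) ^ 2 * (1 - N) ^ 2 * h3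
    rw [h1, h2] at h5
    apply mul_left_cancel₀ hN.ne'
    linear_combination h5
  have hv4 : (v + 4) * N = (1 + N) ^ 2 := by linear_combination hv
  rw [← hv, ← hv4] at h4
  have h6 : N ^ 2 * ((3 / r - Real.cos θ) ^ 2 * v + Real.sin θ ^ 2 * (v + 4) - v * (v + 4)) = 0 := by
    linear_combination h4
  have h7 := (mul_eq_zero.1 h6).resolve_left (pow_ne_zero 2 hN.ne')
  linear_combination -h7

theorem le_coeff (h : IsSmallRoot r θ l) :
    4 * (1 - Real.cos θ) + 12 * (1 - r) ≤ (3 / r - Real.cos θ) ^ 2 + Real.sin θ ^ 2 - 4 := by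
  have h0 := h.pos
  have h1 := h.lt_one
  have h2 : 3 + 3 * (1 - r) ≤ 3 / r := by
    rw [le_div_iff₀ h0]
    nlinarith [sq_nonneg (1 - r)]
  have h3 := Real.cos_le_one θ
  nlinarith [sq_nonneg (Real.sin θ), sq_nonneg (3 / r - Real.cos θ - 2)]

/-- Completing the square, `(v - b/2)² = 4 sin² θ + b²/4`, gives `v ≥ b/2 + 2 |sin θ|`; then
`le_coeff` bounds `b` below. -/
theorem le_gapSq (h : IsSmallRoot r θ l) :
    2 * |Real.sin θ| + 2 * (1 - Real.cos θ) + 6 * (1 - r) ≤ gapSq l := by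
  have hq := h.gapSq_quadratic
  have hb := h.le_coeff
  have hv := h.gapSq_pos
  set b := (3 / r - Real.cos θ) ^ 2 + Real.sin θ ^ 2 - 4
  have hb0 : 0 ≤ b := by
    have := h.lt_one
    have := Real.cos_le_one θ
    linarith
  have h1 : b ≤ gapSq l := by
    by_contra hc
    nlinarith [sq_nonneg (Real.sin θ)]
  have h2 : 2 * |Real.sin θ| ≤ gapSq l - b / 2 := by
    have h3 : |2 * Real.sin θ| ≤ gapSq l - b / 2 := by
      refine abs_le_of_sq_le_sq ?_ (by linarith)
      nlinarith [sq_nonneg b]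
    rwa [abs_mul, abs_two] at h3
  linarith

theorem gapSq_le (h : IsSmallRoot r θ l) :
    gapSq l ≤ (3 / r - Real.cos θ) ^ 2 + Real.sin θ ^ 2 - 4 + 2 * |Real.sin θ| := by
  have hq := h.gapSq_quadratic
  have hb := h.le_coeff
  set b := (3 / r - Real.cos θ) ^ 2 + Real.sin θ ^ 2 - 4
  have hb0 : 0 ≤ b := by
    have := h.lt_one
    have := Real.cos_le_one θ
    linarith
  by_contra hc
  have hs := abs_nonneg (Real.sin θ)
  have h1 : 2 * |Real.sin θ| < gapSq l - b := by linarith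
  have h2 : 2 * |Real.sin θ| < gapSq l := by linarith
  have h3 := mul_lt_mul'' h2 h1 (by positivity) (by positivity)
  rw [hq] at h3
  have h4 := sq_abs (Real.sin θ)
  nlinarith

theorem abs_le_gapSq (h : IsSmallRoot r θ l) (hθ : |θ| ≤ Real.pi) : |θ| ≤ gapSq l := by
  have h1 := h.le_gapSq
  have h2 := h.lt_one
  linarith [abs_le_two_mul_abs_sin_add hθ]

theorem re_pos (h : IsSmallRoot r θ l) : 0 < l.re := by
  have h1 := h.re_im.1
  have hN := h.normSq_pos
  have h3 : 3 < 3 / r := by rw [lt_div_iff₀ h.pos]; linarith [h.lt_one]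
  have h4 : 0 < l.re * (1 + Complex.normSq l) := by
    rw [h1]
    exact mul_pos hN (by linarith [Real.cos_le_one θ])
  exact pos_of_mul_pos_left h4 (by linarith)

/-- In `re_im` the factor `3/r - cos θ` exceeds 2, hence exceeds `1 + |l|²`. -/
theorem normSq_le_re (h : IsSmallRoot r θ l) : Complex.normSq l ≤ l.re := by
  have h1 := h.re_im.1
  have hN := h.normSq_pos
  have hN1 := h.normSq_lt_one
  have h3 : 3 < 3 / r := by rw [lt_div_iff₀ h.pos]; linarith [h.lt_one]
  have h4 := Real.cos_le_one θ
  by_contra hc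
  nlinarith

theorem re_le_sqrt (l : ℂ) : l.re ≤ √(Complex.normSq l) := by
  refine Real.le_sqrt_of_sq_le ?_
  rw [Complex.normSq_apply]
  nlinarith [sq_nonneg l.im]

/-- Bound for the error terms of the integrand. -/
theorem sqrt_normSq_div_le (h : IsSmallRoot r θ l) (hθ : |θ| ≤ Real.pi) (h0 : θ ≠ 0) :
    √(Complex.normSq l) / (1 - Complex.normSq l) ≤ 1 / √|θ| := by
  rw [← h.sqrt_mul_sqrt_gapSq]
  have h1 : 0 < √(Complex.normSq l) := Real.sqrt_pos.2 h.normSq_pos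
  have h2 : 0 < √|θ| := Real.sqrt_pos.2 (abs_pos.2 h0)
  rw [div_mul_cancel_left₀ h1.ne', ← one_div]
  exact one_div_le_one_div_of_le h2 (Real.sqrt_le_sqrt (h.abs_le_gapSq hθ))

/-- Closed form of the integrand in the integral representation of the number of crossings. -/
theorem integrand_eq (h : IsSmallRoot r θ l) (hcos : Real.cos θ ≠ 1) {a : ℝ} {K T : ℝ}
    (hK : K * (1 - Complex.normSq l) = l.re)
    (hT : (1 - Real.cos θ) * T = Real.sin θ * l.im - (1 - Real.cos θ) * (l.re - a)) :
    K * T = l.re * (1 + Real.cos θ) / gapSq l -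
      l.re / (1 - Complex.normSq l) * (l.re - a) := by
  have hc : 1 - Real.cos θ ≠ 0 := sub_ne_zero.2 (Ne.symm hcos)
  have hN := h.normSq_pos
  have hN1 : 1 - Complex.normSq l ≠ 0 := by linarith [h.normSq_lt_one]
  have him := h.re_im.2
  set N := Complex.normSq l
  have hT2 : T = N * (1 + Real.cos θ) / (1 - N) - (l.re - a) := by
    apply mul_left_cancel₀ hc
    rw [hT]
    have : l.im = N * Real.sin θ / (1 - N) := by rw [eq_div_iff hN1, him]
    rw [this]
    field_simp
    linear_combination N * Real.sin_sq_add_cos_sq θ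
  have hK2 : K = l.re / (1 - N) := by rw [eq_div_iff hN1, hK]
  rw [hK2, hT2]
  unfold gapSq
  change _ = l.re * (1 + Real.cos θ) / ((1 - N) ^ 2 / N) - _
  field_simp

/-- Since `l.re ≤ |l|`, the quotient is at most the inverse root of the gap square; the bound is
integrable and independent of `r`. -/
theorem abs_error_le (h : IsSmallRoot r θ l) (hθ : |θ| ≤ Real.pi) (h0 : θ ≠ 0) {a : ℝ}
    (ha0 : 0 ≤ a) (ha1 : a ≤ 1) :
    |l.re / (1 - Complex.normSq l) * (l.re - a)| ≤ 2 * (1 / √|θ|) := by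
  have h1 : 0 < 1 - Complex.normSq l := by linarith [h.normSq_lt_one]
  have h2 := h.re_pos
  have h3 : l.re ≤ 1 := (Complex.re_le_norm l).trans h.norm_lt.le
  rw [abs_mul, abs_of_pos (div_pos h2 h1), mul_comm]
  refine mul_le_mul (abs_le.2 ⟨by linarith, by linarith⟩) ?_ (div_pos h2 h1).le (by norm_num)
  exact (div_le_div_of_nonneg_right (re_le_sqrt l) h1.le).trans (h.sqrt_normSq_div_le hθ h0)

/-- After `l.re ≤ 1`, the two parts of the denominator are compared with `le_gapSq`: `|θ| (1 + cos
θ) ≤ 2 |sin θ|` and `3 (1 + cos θ) ≤ 6`. -/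
theorem main_term_le (h : IsSmallRoot r θ l) (hθ : |θ| ≤ Real.pi) :
    l.re * (1 + Real.cos θ) / gapSq l ≤ 1 / (|θ| + 3 * (1 - r)) := by
  have h1 := h.lt_one
  have h3 : l.re ≤ 1 := (Complex.re_le_norm l).trans h.norm_lt.le
  have h4 : 0 ≤ 1 + Real.cos θ := by linarith [Real.neg_one_le_cos θ]
  have h5 : 0 < |θ| + 3 * (1 - r) := by linarith [abs_nonneg θ]
  rw [div_le_div_iff₀ h.gapSq_pos h5, one_mul]
  have h6 : l.re * (1 + Real.cos θ) ≤ 1 + Real.cos θ := mul_le_of_le_one_left h4 h3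
  have h7 := abs_mul_one_add_cos_le hθ
  have h8 := h.le_gapSq
  have h9 := Real.cos_le_one θ
  calc _ ≤ (1 + Real.cos θ) * (|θ| + 3 * (1 - r)) := mul_le_mul_of_nonneg_right h6 h5.le
    _ ≤ _ := by nlinarith

theorem le_main_term_of_abs_le_one (h : IsSmallRoot r θ l) (hr : 1 / 2 ≤ r) (hθ : |θ| ≤ 1) (h0 : θ ≠ 0) :
    1 / (|θ| + 24 * (1 - r)) - 3 - 2 * (1 / √|θ|) ≤ l.re * (1 + Real.cos θ) / gapSq l := by
  have hpi : |θ| ≤ Real.pi := hθ.trans (by linarith [Real.pi_gt_three])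
  have ht := abs_pos.2 h0
  have hlt := h.lt_one
  have hv := h.gapSq_pos
  have hvt := h.abs_le_gapSq hpi
  have hN := h.normSq_pos
  have hN1 := h.normSq_lt_one
  have hcos : 1 - θ ^ 2 / 2 ≤ Real.cos θ := Real.one_sub_sq_div_two_le_cos
  have hcos1 := Real.cos_le_one θ
  have hsin : |Real.sin θ| ≤ |θ| := Real.abs_sin_le_abs
  have hsin2 : Real.sin θ ^ 2 ≤ |θ| ^ 2 := by
    rw [← sq_abs]; exact pow_le_pow_left₀ (abs_nonneg _) hsin 2
  rw [← sq_abs] at hcos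
  have hrec : 3 / r ≤ 3 + 6 * (1 - r) := by
    rw [div_le_iff₀ h.pos]
    nlinarith
  have hrec2 : 3 ≤ 3 / r := by rw [le_div_iff₀ h.pos]; linarith
  set t := |θ|
  -- With `x = 6(1 - r) + t²/2 ≤ 7/2` one has `(2 + x)² - 4 ≤ 15x/2`, and `sin² θ ≤ t²`; together at
  -- most `45(1 - r) + 19t²/4`, rounded up.
  have hvle : gapSq l ≤ 2 * t + 48 * (1 - r) + 5 * t ^ 2 := by
    refine h.gapSq_le.trans ?_
    have h1 : (3 / r - Real.cos θ) ^ 2 ≤ (2 + (6 * (1 - r) + t ^ 2 / 2)) ^ 2 :=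
      pow_le_pow_left₀ (by linarith) (by linarith) 2
    have h2 : 6 * (1 - r) + t ^ 2 / 2 ≤ 7 / 2 := by nlinarith
    have h3 : 0 ≤ 6 * (1 - r) + t ^ 2 / 2 := by nlinarith
    nlinarith
  -- `1 - |l|²` is `|l|` times the root of the gap square, and `|l| ≤ 1`.
  have hsv : 1 - √(gapSq l) ≤ Complex.normSq l := by
    have h1 := h.sqrt_mul_sqrt_gapSq
    have h2 : √(Complex.normSq l) ≤ 1 := Real.sqrt_le_one.2 hN1.le
    have h3 := Real.sqrt_nonneg (gapSq l)
    nlinarith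
  have hnum : 2 - 2 * √(gapSq l) - t ^ 2 / 2 ≤ l.re * (1 + Real.cos θ) := by
    have h1 : Complex.normSq l * (2 - t ^ 2 / 2) ≤ l.re * (1 + Real.cos θ) :=
      mul_le_mul h.normSq_le_re (by linarith) (by nlinarith) h.re_pos.le
    nlinarith [sq_nonneg t]
  have h1 : (2 - 2 * √(gapSq l) - t ^ 2 / 2) / gapSq l ≤ l.re * (1 + Real.cos θ) / gapSq l :=
    div_le_div_of_nonneg_right hnum hv.le
  refine le_trans ?_ h1
  have e1 : (2 - 2 * √(gapSq l) - t ^ 2 / 2) / gapSq l =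
      2 / gapSq l - 2 * (1 / √(gapSq l)) - t ^ 2 / 2 / gapSq l := by
    have h2 : √(gapSq l) / gapSq l = 1 / √(gapSq l) := Real.sqrt_div_self'
    rw [sub_div, sub_div, mul_div_assoc, h2]
  rw [e1]
  have h2 : 1 / √(gapSq l) ≤ 1 / √t :=
    one_div_le_one_div_of_le (Real.sqrt_pos.2 ht) (Real.sqrt_le_sqrt hvt)
  have h3 : t ^ 2 / 2 / gapSq l ≤ 1 / 2 := by
    rw [div_le_iff₀ hv]
    nlinarith
  -- With `a = t + 24(1 - r)`, the difference `1/a - 2/(2a + 5t²)` equals `5t²/(a(2a + 5t²))`, at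
  -- most `5/2` because `a ≥ t`. With the `1/2` of `h3` this makes the constant 3.
  have h4 : 1 / (t + 24 * (1 - r)) - 5 / 2 ≤ 2 / gapSq l := by
    have h5 : 2 / (2 * t + 48 * (1 - r) + 5 * t ^ 2) ≤ 2 / gapSq l :=
      div_le_div_of_nonneg_left (by norm_num) hv hvle
    refine le_trans ?_ h5
    have h6 : 0 < t + 24 * (1 - r) := by linarith
    have h7 : 0 < 2 * t + 48 * (1 - r) + 5 * t ^ 2 := by nlinarith
    rw [div_sub' h6.ne', div_le_div_iff₀ h6 h7]
    have h8 : 0 ≤ 1 - r := by linarith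
    have h9 := mul_nonneg ht.le h8
    have h10 := mul_nonneg (sq_nonneg t) h8
    nlinarith [pow_pos ht 3, sq_nonneg t, sq_nonneg (1 - r)]
  linarith

theorem main_term_nonneg (h : IsSmallRoot r θ l) : 0 ≤ l.re * (1 + Real.cos θ) / gapSq l :=
  div_nonneg (mul_nonneg h.re_pos.le (by linarith [Real.neg_one_le_cos θ])) h.gapSq_pos.le

/-- For `|θ| ≥ 1` the lower bound is negative while the main term is nonnegative, so only small
angles matter. -/
theorem le_main_term_of_ne_zero (h : IsSmallRoot r θ l) (hr : 1 / 2 ≤ r) (h0 : θ ≠ 0) :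
    1 / (|θ| + 24 * (1 - r)) - 3 - 2 * (1 / √|θ|) ≤ l.re * (1 + Real.cos θ) / gapSq l := by
  rcases le_total |θ| 1 with h1 | h1
  · exact h.le_main_term_of_abs_le_one hr h1 h0
  · refine le_trans ?_ h.main_term_nonneg
    have h2 : 1 / (|θ| + 24 * (1 - r)) ≤ 1 := by
      rw [div_le_one] <;> linarith [h.lt_one]
    have h3 : 0 ≤ 1 / √|θ| := by positivity
    linarith

/-- Bound for the Fourier transform of the Green function. -/
theorem norm_green_le (h : IsSmallRoot r θ l) (hr : 1 / 2 ≤ r) (hθ : |θ| ≤ Real.pi) (h0 : θ ≠ 0)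
    {G : ℂ} (hG : G * (1 - Complex.normSq l) = 1 + l ^ 2) : ‖G‖ ≤ 7 * (1 / √|θ|) := by
  have h1 : 0 < 1 - Complex.normSq l := by linarith [h.normSq_lt_one]
  have h2 := congrArg norm hG
  have h3 : ‖(1 - Complex.normSq l : ℂ)‖ = 1 - Complex.normSq l := by
    rw [← Complex.ofReal_one, ← Complex.ofReal_sub, Complex.norm_real, Real.norm_of_nonneg h1.le]
  have h4 : ‖l‖ = √(Complex.normSq l) := by
    rw [Complex.normSq_eq_norm_sq, Real.sqrt_sq (norm_nonneg _)]
  have h5 : ‖(3 / r - Complex.exp (θ * Complex.I) : ℂ)‖ ≤ 7 := by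
    refine (norm_sub_le _ _).trans ?_
    rw [Complex.norm_exp_ofReal_mul_I, norm_div, Complex.norm_real, Real.norm_of_nonneg h.pos.le]
    have : 3 / r ≤ 6 := by rw [div_le_iff₀ h.pos]; linarith
    norm_num
    linarith
  rw [norm_mul, h3, add_comm, h.eq, norm_mul, h4] at h2
  have h6 : ‖G‖ = ‖(3 / r - Complex.exp (θ * Complex.I) : ℂ)‖ *
      (√(Complex.normSq l) / (1 - Complex.normSq l)) := by
    rw [← mul_div_assoc, eq_div_iff h1.ne', h2]
  rw [h6]
  exact mul_le_mul h5 (h.sqrt_normSq_div_le hθ h0) (by positivity) (by norm_num)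

end IsSmallRoot

/-! ### Comparison integrals and the first moment of the return law -/

theorem intervalIntegrable_one_div_sqrt_abs {a : ℝ} (ha : 0 ≤ a) :
    IntervalIntegrable (fun θ : ℝ => 1 / √|θ|) volume (-a) a := by
  have h1 : IntervalIntegrable (fun θ : ℝ => 1 / √|θ|) volume 0 a := by
    refine (intervalIntegral.intervalIntegrable_rpow' (r := -(1 / 2)) (by norm_num)).congr
      fun θ hθ => ?_
    rw [Set.uIoc_of_le ha] at hθ
    simp only [abs_of_pos hθ.1, Real.sqrt_eq_rpow, Real.rpow_neg hθ.1.le, one_div]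
  have h2 : IntervalIntegrable (fun θ : ℝ => 1 / √|θ|) volume (-a) 0 := by
    have := (IntervalIntegrable.iff_comp_neg (a := 0) (b := a)
      (f := fun θ : ℝ => 1 / √|θ|)).1 h1
    simp only [abs_neg, neg_zero] at this
    exact this.symm
  exact h2.trans h1

theorem integral_one_div_abs_add {a b : ℝ} (ha : 0 < a) (hb : 0 ≤ b) :
    ∫ θ in (-b)..b, 1 / (|θ| + a) = 2 * (Real.log (b + a) - Real.log a) := by
  have hc : Continuous fun θ : ℝ => 1 / (|θ| + a) :=
    continuous_const.div (by fun_prop) fun θ => by positivity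
  have h1 : ∫ θ in (0 : ℝ)..b, 1 / (|θ| + a) = Real.log (b + a) - Real.log a := by
    have e1 : ∫ θ in (0 : ℝ)..b, 1 / (|θ| + a) = ∫ θ in (0 : ℝ)..b, 1 / (θ + a) := by
      refine intervalIntegral.integral_congr fun θ hθ => ?_
      rw [Set.uIcc_of_le hb] at hθ
      simp only [abs_of_nonneg hθ.1]
    rw [e1, intervalIntegral.integral_comp_add_right (fun x => 1 / x), integral_one_div_of_pos
      (by linarith) (by linarith), Real.log_div (by linarith) (by linarith), zero_add]
  have h2 : ∫ θ in (-b)..0, 1 / (|θ| + a) = ∫ θ in (0 : ℝ)..b, 1 / (|θ| + a) := by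
    have := intervalIntegral.integral_comp_neg (a := 0) (b := b) fun θ : ℝ => 1 / (|θ| + a)
    simp only [abs_neg, neg_zero] at this
    exact this.symm
  rw [← intervalIntegral.integral_add_adjacent_intervals (hc.intervalIntegrable _ 0)
    (hc.intervalIntegrable _ _), h2, h1]
  ring

/-- The displacement is at most the duration `u`, so the first moment is dominated by the sum of `u
* r ^ u`. It justifies the exchange of sum and integral, since the Dirichlet kernels grow linearly
in `k`. -/
theorem summable_nat_mul_returnLaw {r : ℝ≥0∞} (hr : r < 1) :
    Summable fun k : ℕ => (k : ℝ) * (returnLaw r k).toReal := by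
  have h1 : ∑' u : ℕ, (u : ℝ≥0∞) * r ^ u ≠ ⊤ := by
    lift r to NNReal using hr.ne_top
    have h2 : Summable fun u : ℕ => (u : ℝ) ^ 1 * (r : ℝ) ^ u :=
      summable_pow_mul_geometric_of_norm_lt_one 1 (by simpa using hr)
    have h3 : Summable fun u : ℕ => (u : NNReal) * r ^ u := by
      rw [← NNReal.summable_coe]
      simpa using h2
    have := ENNReal.tsum_coe_ne_top_iff_summable.2 h3
    simpa using this
  have h2 : ∑' k : ℕ, (k : ℝ≥0∞) * halfPlaneGreen r k 1 ≠ ⊤ := by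
    refine ne_top_of_le_ne_top h1 ?_
    unfold halfPlaneGreen genFun
    simp_rw [← ENNReal.tsum_mul_left]
    rw [ENNReal.tsum_comm]
    refine ENNReal.tsum_le_tsum fun u => ?_
    calc ∑' k : ℕ, (k : ℝ≥0∞) * (r ^ u * halfPlaneProb u k 1)
        ≤ ∑' k : ℕ, (u : ℝ≥0∞) * r ^ u * halfPlaneProb u k 1 := by
          refine ENNReal.tsum_le_tsum fun k => ?_
          rcases le_or_gt k u with hk | hk
          · rw [mul_assoc]
            exact mul_le_mul_left (Nat.cast_le.2 hk) _
          · simp [halfPlaneProb_of_lt u (show (u : ℤ) < (k : ℤ) by exact_mod_cast hk)]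
      _ = (u : ℝ≥0∞) * r ^ u * ∑' k : ℕ, halfPlaneProb u k 1 := ENNReal.tsum_mul_left
      _ ≤ (u : ℝ≥0∞) * r ^ u * 1 := by
          refine mul_le_mul_right ?_ _
          refine le_trans ?_ (tsum_halfPlaneProb_le u 1)
          exact ENNReal.tsum_comp_le_tsum_of_injective (Nat.cast_injective (R := ℤ)) _
      _ = _ := mul_one _
  have h3 : ∀ k : ℕ, (k : ℝ) * (returnLaw r k).toReal =
      (r * 3⁻¹ * ((k : ℝ≥0∞) * halfPlaneGreen r k 1)).toReal := by
    intro k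
    rw [returnLaw]
    simp only [ENNReal.toReal_mul, ENNReal.toReal_natCast]
    ring
  simp_rw [h3]
  refine ENNReal.summable_toReal ?_
  rw [ENNReal.tsum_mul_left]
  exact ENNReal.mul_ne_top (ENNReal.mul_ne_top hr.ne_top (by norm_num)) h2

/-! ### Uniform bounds as the discount tends to one -/

section Bounds

variable {Ω : Type*} [MeasurableSpace Ω] {μ : Measure Ω} [IsProbabilityMeasure μ]
  {M : ℕ → Ω → ℤ × ℤ} {r : ℝ≥0∞}

theorem isSmallRoot_returnLaw (hr0 : r ≠ 0) (hr : r < 1) (θ : ℝ) :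
    IsSmallRoot r.toReal θ (fourierSum (fun k => (returnLaw r k).toReal) θ) := by
  obtain ⟨h1, h2⟩ := fourierSum_returnLaw hr0 hr θ
  refine ⟨ENNReal.toReal_pos hr0 hr.ne_top, ?_, h1, h2⟩
  have := (ENNReal.toReal_lt_toReal hr.ne_top ENNReal.one_ne_top).2 hr
  simpa using this

/-- The total mass is the characteristic function at `θ = 0`, a root of modulus less than one. -/
theorem tsum_returnLaw_le_one (hr0 : r ≠ 0) (hr : r < 1) : ∑' k, returnLaw r k ≤ 1 := by
  have hR := tsum_returnLaw_ne_top hr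
  have h1 := (fourierSum_returnLaw hr0 hr 0).1
  have h2 : fourierSum (fun k => (returnLaw r k).toReal) 0 =
      ((∑' k, (returnLaw r k).toReal : ℝ) : ℂ) := by
    rw [fourierSum, Complex.ofReal_tsum]
    simp
  rw [h2, Complex.norm_real, Real.norm_of_nonneg (tsum_nonneg fun _ => ENNReal.toReal_nonneg),
    ← ENNReal.tsum_toReal_eq (ENNReal.ne_top_of_tsum_ne_top hR)] at h1
  rw [← ENNReal.toReal_le_toReal hR ENNReal.one_ne_top, ENNReal.toReal_one]
  exact h1.le

theorem cos_ne_one {θ : ℝ} (hθ : |θ| ≤ Real.pi) (h0 : θ ≠ 0) : Real.cos θ ≠ 1 := by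
  obtain ⟨h1, h2⟩ := abs_le.1 hθ
  have := Real.pi_pos
  rwa [Ne, Real.cos_eq_one_iff_of_lt_of_lt (by linarith) (by linarith)]

theorem ae_ne_zero_real : ∀ᵐ θ : ℝ, θ ≠ 0 := by
  rw [ae_iff]
  simp

/-- Fourier inversion together with `norm_green_le`: the singularity `|θ|^(-1/2)` is integrable, so
the bound depends neither on `r` nor on `m`. -/
theorem toReal_hitGreen_le (h : IsSimpleRandomWalk graphG1 (0, 0) μ M) (hr : r < 1)
    (hr2 : 1 / 2 ≤ r.toReal) (m : ℤ) : (hitGreen μ M r m).toReal ≤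
      (2 * Real.pi)⁻¹ * (7 * ∫ θ in (-Real.pi)..Real.pi, 1 / √|θ|) := by
  have hr0 : r ≠ 0 := by rintro rfl; norm_num at hr2
  have hpi := Real.pi_pos
  have hs := ENNReal.summable_toReal (tsum_hitGreen_ne_top h hr)
  have h1 := congrArg norm (integral_fourierSum_mul hs m)
  have h2 : ‖(2 * Real.pi * ((hitGreen μ M r m).toReal : ℂ) : ℂ)‖ =
      2 * Real.pi * (hitGreen μ M r m).toReal := by
    rw [norm_mul, norm_mul, Complex.norm_real, Complex.norm_real,
      Real.norm_of_nonneg ENNReal.toReal_nonneg, Real.norm_of_nonneg hpi.le]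
    simp
  rw [h2] at h1
  rw [inv_mul_eq_div, le_div_iff₀' (by positivity), ← h1,
    ← intervalIntegral.integral_const_mul]
  refine intervalIntegral.norm_integral_le_of_norm_le (by linarith) ?_
    ((intervalIntegrable_one_div_sqrt_abs hpi.le).const_mul 7)
  filter_upwards [ae_ne_zero_real] with θ h0 hθ
  have hθ' : |θ| ≤ Real.pi := abs_le.2 ⟨hθ.1.le, hθ.2⟩
  have h3 : ‖Complex.exp (-(m * θ * Complex.I))‖ = 1 := by
    have := norm_exp_int_mul (-m) θ
    push_cast at this
    rwa [neg_mul, neg_mul] at this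
  rw [norm_mul, h3, mul_one]
  exact (isSmallRoot_returnLaw hr0 hr θ).norm_green_le hr2 hθ' h0
    (fourierSum_green h hr0 hr θ rfl).1

theorem crossingGreen_ne_top (h : IsSimpleRandomWalk graphG1 (0, 0) μ M) (hr : r < 1) :
    crossingGreen μ M r ≠ ⊤ := by
  refine ne_top_of_le_ne_top (ENNReal.mul_ne_top (tsum_exitGreen_ne_top h hr)
    (tsum_returnLaw_ne_top hr)) ?_
  rw [crossingGreen, ← ENNReal.tsum_mul_right]
  refine ENNReal.tsum_le_tsum fun e => mul_le_mul_right (ENNReal.tsum_le_tsum fun k => ?_) _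
  split_ifs <;> simp

theorem toReal_crossingGreen (h : IsSimpleRandomWalk graphG1 (0, 0) μ M) (hr : r < 1) :
    (crossingGreen μ M r).toReal = (2 * Real.pi)⁻¹ * ∫ θ in (-Real.pi)..Real.pi,
      (fourierSum (fun e => (exitGreen μ M r e).toReal) θ).re *
        ∑' k : ℕ, (returnLaw r k).toReal * dirichletSum k θ := by
  have hK := tsum_exitGreen_ne_top h hr
  have hR := tsum_returnLaw_ne_top hr
  rw [← (hasSum_mul_windowSum (ENNReal.summable_toReal hK) (fun _ => ENNReal.toReal_nonneg)
    (summable_nat_mul_returnLaw hr)).tsum_eq]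
  have e1 : crossingGreen μ M r =
      ∑' k : ℕ, returnLaw r k * ∑' e : ℤ, if |e| < k then exitGreen μ M r e else 0 := by
    unfold crossingGreen
    simp_rw [← ENNReal.tsum_mul_left]
    rw [ENNReal.tsum_comm, ← (Nat.cast_injective (R := ℤ)).tsum_eq]
    · refine tsum_congr fun k => tsum_congr fun e => ?_
      split_ifs <;> ring
    · intro j hj
      have : 0 ≤ j := by
        by_contra hc
        refine hj ?_
        simp [returnLaw_of_neg r (not_le.1 hc)]
      exact ⟨j.toNat, by simp [this]⟩
  have hC := crossingGreen_ne_top h hr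
  rw [e1] at hC ⊢
  rw [ENNReal.tsum_toReal_eq (ENNReal.ne_top_of_tsum_ne_top hC)]
  refine tsum_congr fun k => ?_
  rw [ENNReal.toReal_mul, windowSum, ENNReal.tsum_toReal_eq]
  · congr 1
    refine tsum_congr fun e => ?_
    split_ifs <;> simp
  · intro e
    split_ifs
    · exact ENNReal.ne_top_of_tsum_ne_top hK e
    · simp

/-- Pointwise bounds for the integrand of `toReal_crossingGreen`. -/
theorem crossing_integrand_bounds (h : IsSimpleRandomWalk graphG1 (0, 0) μ M) (hr : r < 1)
    (hr2 : 1 / 2 ≤ r.toReal) {θ : ℝ} (hθ : |θ| ≤ Real.pi) (h0 : θ ≠ 0) :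
    (fourierSum (fun e => (exitGreen μ M r e).toReal) θ).re *
        (∑' k : ℕ, (returnLaw r k).toReal * dirichletSum k θ) ≤
      1 / (|θ| + 3 * (1 - r.toReal)) + 2 * (1 / √|θ|) ∧
    1 / (|θ| + 24 * (1 - r.toReal)) - 3 - 4 * (1 / √|θ|) ≤
      (fourierSum (fun e => (exitGreen μ M r e).toReal) θ).re *
        ∑' k : ℕ, (returnLaw r k).toReal * dirichletSum k θ := by
  have hr0 : r ≠ 0 := by rintro rfl; norm_num at hr2
  have hR := tsum_returnLaw_ne_top hr
  have hl := isSmallRoot_returnLaw hr0 hr θ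
  have hK := congrArg Complex.re (fourierSum_green h hr0 hr θ rfl).2
  rw [← Complex.ofReal_one, ← Complex.ofReal_sub, Complex.re_mul_ofReal] at hK
  have hT := one_sub_cos_mul_tsum (ENNReal.summable_toReal hR)
    (fun k hk => by rw [returnLaw_of_neg r hk, ENNReal.toReal_zero]) θ
  have ha1 : (returnLaw r 0).toReal ≤ 1 := by
    have := (ENNReal.le_tsum 0).trans (tsum_returnLaw_le_one hr0 hr)
    exact ENNReal.toReal_mono ENNReal.one_ne_top this
  rw [hl.integrand_eq (cos_ne_one hθ h0) hK hT]
  have herr := abs_le.1 (hl.abs_error_le hθ h0 ENNReal.toReal_nonneg ha1)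
  have hup := hl.main_term_le hθ
  have hlo := hl.le_main_term_of_ne_zero hr2 h0
  constructor <;> linarith [herr.1, herr.2]

/-- Each comparison integral of `1/(|θ| + c(1 - r))` is `2 log(1/(1-r)) + O(1)`, and the prefactor
`1/(2π)` makes this `1/π` times the logarithm. The different values `c = 3` and `c = 24` affect only
the bounded part. -/
theorem toReal_crossingGreen_bounds (h : IsSimpleRandomWalk graphG1 (0, 0) μ M) (hr : r < 1)
    (hr2 : 1 / 2 ≤ r.toReal) :
    |(crossingGreen μ M r).toReal - 1 / Real.pi * Real.log (1 / (1 - r.toReal))| ≤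
      1 / Real.pi * (Real.log 24 + 3 * Real.pi + 2 * ∫ θ in (-Real.pi)..Real.pi, 1 / √|θ|) := by
  have hpi := Real.pi_pos
  have hpi3 := Real.pi_gt_three
  have hpi4 := Real.pi_le_four
  have hr1 : r.toReal < 1 := by
    have := (ENNReal.toReal_lt_toReal hr.ne_top ENNReal.one_ne_top).2 hr
    simpa using this
  have hd : 0 < 1 - r.toReal := by linarith
  have hK := ENNReal.summable_toReal (tsum_exitGreen_ne_top h hr)
  have hcont : Continuous fun θ => (fourierSum (fun e => (exitGreen μ M r e).toReal) θ).re *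
        ∑' k : ℕ, (returnLaw r k).toReal * dirichletSum k θ :=
    (Complex.continuous_re.comp (continuous_fourierSum hK)).mul
      (continuous_tsum_mul_dirichletSum (fun _ => ENNReal.toReal_nonneg)
        (summable_nat_mul_returnLaw hr))
  have hJ := intervalIntegrable_one_div_sqrt_abs hpi.le
  have hJ0 : 0 ≤ ∫ θ in (-Real.pi)..Real.pi, 1 / √|θ| :=
    intervalIntegral.integral_nonneg (by linarith) fun θ _ => by positivity
  have hmain : ∀ a : ℝ, 0 < a →
      IntervalIntegrable (fun θ : ℝ => 1 / (|θ| + a)) volume (-Real.pi) Real.pi := fun a ha =>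
    (continuous_const.div (by fun_prop) fun θ => by positivity : Continuous fun θ : ℝ =>
      1 / (|θ| + a)).intervalIntegrable _ _
  have hlogd : Real.log (1 / (1 - r.toReal)) = -Real.log (1 - r.toReal) := by
    rw [one_div, Real.log_inv]
  have hmem : ∀ θ ∈ Set.Icc (-Real.pi) Real.pi, |θ| ≤ Real.pi := fun θ hθ => abs_le.2 hθ
  have hup : ∫ θ in (-Real.pi)..Real.pi,
      (fourierSum (fun e => (exitGreen μ M r e).toReal) θ).re *
        (∑' k : ℕ, (returnLaw r k).toReal * dirichletSum k θ) ≤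
      2 * (Real.log (Real.pi + 3 * (1 - r.toReal)) - Real.log (3 * (1 - r.toReal))) +
        2 * ∫ θ in (-Real.pi)..Real.pi, 1 / √|θ| := by
    rw [← integral_one_div_abs_add (by linarith) hpi.le, ← intervalIntegral.integral_const_mul,
      ← intervalIntegral.integral_add (hmain _ (by linarith)) (hJ.const_mul 2)]
    refine intervalIntegral.integral_mono_ae_restrict (by linarith)
      (hcont.intervalIntegrable _ _) ((hmain _ (by linarith)).add (hJ.const_mul 2)) ?_
    refine (ae_restrict_iff' measurableSet_Icc).2 ?_
    filter_upwards [ae_ne_zero_real] with θ h0 hθ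
    exact (crossing_integrand_bounds h hr hr2 (hmem θ hθ) h0).1
  have hlo : 2 * (Real.log (Real.pi + 24 * (1 - r.toReal)) - Real.log (24 * (1 - r.toReal))) -
        3 * (2 * Real.pi) - 4 * (∫ θ in (-Real.pi)..Real.pi, 1 / √|θ|) ≤
      ∫ θ in (-Real.pi)..Real.pi, (fourierSum (fun e => (exitGreen μ M r e).toReal) θ).re *
        (∑' k : ℕ, (returnLaw r k).toReal * dirichletSum k θ) := by
    have e3 : 3 * (2 * Real.pi) = ∫ θ in (-Real.pi)..Real.pi, (3 : ℝ) := by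
      rw [intervalIntegral.integral_const, smul_eq_mul]; ring
    rw [← integral_one_div_abs_add (by linarith) hpi.le, ← intervalIntegral.integral_const_mul, e3,
      ← intervalIntegral.integral_sub (hmain _ (by linarith)) (by simp),
      ← intervalIntegral.integral_sub ((hmain _ (by linarith)).sub (by simp)) (hJ.const_mul 4)]
    refine intervalIntegral.integral_mono_ae_restrict (by linarith)
      (((hmain _ (by linarith)).sub (by simp)).sub (hJ.const_mul 4))
      (hcont.intervalIntegrable _ _) ?_
    refine (ae_restrict_iff' measurableSet_Icc).2 ?_
    filter_upwards [ae_ne_zero_real] with θ h0 hθ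
    exact (crossing_integrand_bounds h hr hr2 (hmem θ hθ) h0).2
  rw [toReal_crossingGreen h hr, hlogd]
  set J := ∫ θ in (-Real.pi)..Real.pi, 1 / √|θ|
  set F := ∫ θ in (-Real.pi)..Real.pi, (fourierSum (fun e => (exitGreen μ M r e).toReal) θ).re *
        (∑' k : ℕ, (returnLaw r k).toReal * dirichletSum k θ)
  rw [Real.log_mul (by norm_num) hd.ne'] at hup hlo
  have h3 : 0 ≤ Real.log 3 := Real.log_nonneg (by norm_num)
  have h24 : Real.log (Real.pi + 3 * (1 - r.toReal)) ≤ Real.log 24 :=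
    Real.log_le_log (by linarith) (by linarith)
  have h1 : 0 ≤ Real.log (Real.pi + 24 * (1 - r.toReal)) := Real.log_nonneg (by linarith)
  have e4 : (2 * Real.pi)⁻¹ * F - 1 / Real.pi * -Real.log (1 - r.toReal) =
      1 / Real.pi * (F / 2 + Real.log (1 - r.toReal)) := by
    field_simp
    ring
  rw [e4, abs_mul, abs_of_pos (by positivity : 0 < 1 / Real.pi)]
  refine mul_le_mul_of_nonneg_left (abs_le.2 ⟨?_, ?_⟩) (by positivity) <;> linarith

/-- The generating function of the half windings grows like `π⁻¹ log (1 / (1 - r))`. -/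
theorem exists_genFun_halfWindingProb_bound (h : IsSimpleRandomWalk graphG1 (0, 0) μ M) :
    ∃ C : ℝ, ∀ r : ℝ≥0∞, r < 1 → 1 / 2 ≤ r.toReal →
      |(genFun r (halfWindingProb μ M)).toReal -
        1 / Real.pi * Real.log (1 / (1 - r.toReal))| ≤ C := by
  set S : ℝ := (2 * Real.pi)⁻¹ * (7 * ∫ θ in (-Real.pi)..Real.pi, 1 / √|θ|) with hS
  -- The bound of `originGreen_le`; it does not depend on `r`.
  set R : ℝ≥0∞ := ENNReal.ofReal S *
    (3 * ((3⁻¹ * (1 - 3⁻¹)⁻¹) * (3⁻¹ * (1 - 3⁻¹)⁻¹))) with hRdef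
  have hRtop : R ≠ ⊤ := by
    have h1 : (3⁻¹ : ℝ≥0∞) < 1 := ENNReal.inv_lt_one.2 (by norm_num)
    have h2 := inv_one_sub_ne_top h1
    have h3 : (3⁻¹ : ℝ≥0∞) * (1 - 3⁻¹)⁻¹ ≠ ⊤ := ENNReal.mul_ne_top h1.ne_top h2
    exact ENNReal.mul_ne_top ENNReal.ofReal_ne_top
      (ENNReal.mul_ne_top (by norm_num) (ENNReal.mul_ne_top h3 h3))
  refine ⟨1 / Real.pi * (Real.log 24 + 3 * Real.pi +
    2 * ∫ θ in (-Real.pi)..Real.pi, 1 / √|θ|) + 2 * R.toReal, fun r hr hr2 => ?_⟩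
  have hr0 : r ≠ 0 := by rintro rfl; norm_num at hr2
  have hG : ∀ m, hitGreen μ M r m ≤ ENNReal.ofReal S := by
    intro m
    rw [ENNReal.le_ofReal_iff_toReal_le
      (ENNReal.ne_top_of_tsum_ne_top (tsum_hitGreen_ne_top h hr) m)
      (ENNReal.toReal_nonneg.trans (toReal_hitGreen_le h hr hr2 m))]
    exact toReal_hitGreen_le h hr hr2 m
  have hO : originGreen μ M r ≤ R := originGreen_le hr.le hG
  have hL := tsum_returnLaw_le_one hr0 hr
  have hC := crossingGreen_ne_top h hr
  have hA := genFun_le r (f := halfWindingProb μ M) fun t => prob_le_one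
  have hAtop := ne_top_of_le_ne_top (inv_one_sub_ne_top hr) hA
  have h1 : genFun r (halfWindingProb μ M) ≤ crossingGreen μ M r + 2 * R := by
    refine (genFun_halfWindingProb_le h hr).trans (add_le_add le_rfl ?_)
    refine mul_le_mul' ?_ hO
    exact mul_le_of_le_one_right' hL
  have h2 : crossingGreen μ M r ≤ genFun r (halfWindingProb μ M) + R := by
    refine (crossingGreen_le h hr).trans (add_le_add le_rfl ?_)
    exact (mul_le_of_le_one_left' hL).trans hO
  have h1' := ENNReal.toReal_mono (ENNReal.add_ne_top.2
    ⟨hC, ENNReal.mul_ne_top (by norm_num) hRtop⟩) h1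
  have h2' := ENNReal.toReal_mono (ENNReal.add_ne_top.2 ⟨hAtop, hRtop⟩) h2
  rw [ENNReal.toReal_add hC (ENNReal.mul_ne_top (by norm_num) hRtop), ENNReal.toReal_mul,
    ENNReal.toReal_ofNat] at h1'
  rw [ENNReal.toReal_add hAtop hRtop] at h2'
  have h3 := abs_le.1 (toReal_crossingGreen_bounds h hr hr2)
  have h4 : 0 ≤ R.toReal := ENNReal.toReal_nonneg
  rw [abs_le]
  constructor <;> linarith [h3.1, h3.2]

end Bounds

/-! ### A Tauberian theorem for logarithmic growth -/

theorem tendsto_log_div_self : Tendsto (fun x : ℝ => Real.log x / x) atTop (nhds 0) :=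
  Real.isLittleO_log_id_atTop.tendsto_div_nhds_zero

/-- A Tauberian theorem with logarithmic growth, for coefficients in `[0, 1]`. -/
theorem tendsto_sum_div_log_of_abel {a : ℕ → ℝ} (ha0 : ∀ t, 0 ≤ a t) (ha1 : ∀ t, a t ≤ 1)
    {κ C : ℝ} (hA : ∀ ρ : ℝ, 1 / 2 ≤ ρ → ρ < 1 →
      |∑' t, ρ ^ t * a t - κ * Real.log (1 / (1 - ρ))| ≤ C) :
    Tendsto (fun n : ℕ => (∑ t ∈ Finset.range (n + 1), a t) / Real.log n) atTop (nhds κ) := by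
  have hsum : ∀ ρ : ℝ, 0 ≤ ρ → ρ < 1 → Summable fun t => ρ ^ t * a t := fun ρ h0 h1 =>
    Summable.of_nonneg_of_le (fun t => mul_nonneg (pow_nonneg h0 t) (ha0 t))
      (fun t => mul_le_of_le_one_right (pow_nonneg h0 t) (ha1 t))
      (summable_geometric_of_lt_one h0 h1)
  have hlog : Tendsto (fun n : ℕ => Real.log n) atTop atTop :=
    Real.tendsto_log_atTop.comp tendsto_natCast_atTop_atTop
  have hinv : Tendsto (fun x : ℝ => 1 / x) atTop (nhds 0) := by
    simpa using tendsto_inv_atTop_zero (𝕜 := ℝ)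
  have hlower : Tendsto (fun x : ℝ => κ * (1 - (Real.log 2 * (1 / x) + Real.log x / x)) -
      (C + 1) * (1 / x)) atTop (nhds κ) := by
    have := (((hinv.const_mul (Real.log 2)).add tendsto_log_div_self).const_sub 1).const_mul κ
    simpa using this.sub (hinv.const_mul (C + 1))
  have hupper : Tendsto (fun x : ℝ => (κ * (1 + Real.log x / x) + C * (1 / x)) / (1 - 1 / x))
      atTop (nhds κ) := by
    have h1 := ((tendsto_log_div_self.const_add 1).const_mul κ).add (hinv.const_mul C)
    have h2 := h1.div (hinv.const_sub 1) (by norm_num)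
    simpa only [add_zero, mul_one, mul_zero, sub_zero, div_one, Pi.div_def] using h2
  have hlarge : ∀ᶠ n : ℕ in atTop, 2 ≤ Real.log n ∧ 4 * Real.log n ≤ n ∧ (2 : ℝ) ≤ n := by
    have h1 : ∀ᶠ x : ℝ in atTop, Real.log x / x ≤ 1 / 4 :=
      tendsto_log_div_self.eventually (eventually_le_nhds (by norm_num))
    filter_upwards [hlog.eventually_ge_atTop 2,
      tendsto_natCast_atTop_atTop.eventually h1, tendsto_natCast_atTop_atTop.eventually_ge_atTop
      (2 : ℝ)] with n h2 h3 h4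
    refine ⟨h2, ?_, h4⟩
    rw [div_le_iff₀ (by linarith)] at h3
    linarith
  refine tendsto_of_tendsto_of_tendsto_of_le_of_le' (hlower.comp hlog) (hupper.comp hlog) ?_ ?_
  · filter_upwards [hlarge] with n ⟨h1, h2, h3⟩
    simp only [Function.comp]
    set x := Real.log n with hx
    have hn : (0 : ℝ) < n := by linarith
    have hx0 : 0 < x := by linarith
    -- Here `1 - ρ` exceeds `1/n` by the factor `2 log n`: the terms beyond `n` sum to at most `ρ ^
    -- n / (1 - ρ) ≤ n⁻² * n ≤ 1`, while `log(1/(1-ρ))` falls short of `log n` only by `log(2 log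
    -- n)`.
    set ρ : ℝ := 1 - 2 * x / n with hρ
    have h4 : 2 * x / n ≤ 1 / 2 := by rw [div_le_iff₀ hn]; linarith
    have h5 : 0 < 2 * x / n := by positivity
    have hρ0 : 1 / 2 ≤ ρ := by linarith
    have hρ1 : ρ < 1 := by linarith
    have hb := (abs_le.1 (hA ρ hρ0 hρ1)).1
    have hlogρ : Real.log (1 / (1 - ρ)) = x - (Real.log 2 + Real.log x) := by
      rw [hρ, sub_sub_cancel, one_div_div, Real.log_div hn.ne' (by positivity),
        Real.log_mul two_ne_zero hx0.ne']
    have htail : ∑' t, ρ ^ t * a t ≤ ∑ t ∈ Finset.range (n + 1), a t + 1 := by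
      rw [← (hsum ρ (by linarith) hρ1).sum_add_tsum_nat_add (n + 1)]
      refine add_le_add (Finset.sum_le_sum fun t _ => mul_le_of_le_one_left (ha0 t)
        (pow_le_one₀ (by linarith) hρ1.le)) ?_
      calc ∑' t, ρ ^ (t + (n + 1)) * a (t + (n + 1)) ≤ ∑' t, ρ ^ n * ρ ^ t := by
            refine Summable.tsum_le_tsum (fun t => ?_)
              ((summable_nat_add_iff (n + 1)).2 (hsum ρ (by linarith) hρ1))
              ((summable_geometric_of_lt_one (by linarith) hρ1).mul_left _)
            refine (mul_le_of_le_one_right (pow_nonneg (by linarith) _) (ha1 _)).trans ?_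
            rw [← pow_add]
            exact pow_le_pow_of_le_one (by linarith) hρ1.le (by omega)
        _ = ρ ^ n * (1 - ρ)⁻¹ := by
            rw [tsum_mul_left, tsum_geometric_of_lt_one (by linarith) hρ1]
        _ ≤ Real.exp (-(2 * x)) * n := by
            refine mul_le_mul ?_ ?_ (inv_nonneg.2 (by linarith)) (Real.exp_pos _).le
            · calc ρ ^ n ≤ Real.exp (-(2 * x / n)) ^ n := by
                    refine pow_le_pow_left₀ (by linarith) ?_ n
                    linarith [Real.add_one_le_exp (-(2 * x / n))]
                _ = Real.exp (-(2 * x)) := by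
                    rw [← Real.exp_nat_mul]
                    congr 1
                    field_simp
            · rw [hρ, sub_sub_cancel, inv_div, div_le_iff₀ (by positivity)]
              nlinarith
        _ ≤ 1 := by
            have e1 : Real.exp x = n := Real.exp_log hn
            rw [← e1, ← Real.exp_add, Real.exp_le_one_iff]
            linarith
    rw [hlogρ] at hb
    rw [le_div_iff₀ hx0]
    have e2 : (κ * (1 - (Real.log 2 * (1 / x) + Real.log x / x)) - (C + 1) * (1 / x)) * x =
        κ * (x - (Real.log 2 + Real.log x)) - (C + 1) := by
      field_simp
    rw [e2]
    linarith
  · filter_upwards [hlarge] with n ⟨h1, h2, h3⟩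
    simp only [Function.comp]
    set x := Real.log n with hx
    have hn : (0 : ℝ) < n := by linarith
    have hx0 : 0 < x := by linarith
    have hnx : 4 ≤ n * x := by nlinarith
    -- Here `1 - ρ` is smaller than `1/n` by the factor `log n`: by Bernoulli's inequality all
    -- weights up to time `n` are at least `1 - 1/log n`, while `log(1/(1-ρ))` exceeds `log n` only
    -- by `log log n`.
    set ρ : ℝ := 1 - 1 / (n * x) with hρ
    have h4 : 1 / (n * x) ≤ 1 / 2 := by rw [div_le_iff₀ (by linarith)]; linarith
    have h5 : 0 < 1 / (n * x) := by positivity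
    have hρ0 : 1 / 2 ≤ ρ := by linarith
    have hρ1 : ρ < 1 := by linarith
    have hb := (abs_le.1 (hA ρ hρ0 hρ1)).2
    have hlogρ : Real.log (1 / (1 - ρ)) = x + Real.log x := by
      rw [hρ, sub_sub_cancel, one_div_one_div, Real.log_mul hn.ne' hx0.ne']
    have hbern : 1 - 1 / x ≤ ρ ^ n := by
      have := one_add_mul_le_pow (a := -(1 / (n * x))) (by linarith) n
      have e3 : (1 : ℝ) + n * -(1 / (n * x)) = 1 - 1 / x := by field_simp; ring
      rw [e3] at this
      exact this
    have hx1 : 0 < 1 - 1 / x := by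
      have : 1 / x ≤ 1 / 2 := one_div_le_one_div_of_le two_pos h1
      linarith
    have hU : (∑ t ∈ Finset.range (n + 1), a t) * (1 - 1 / x) ≤ ∑' t, ρ ^ t * a t := by
      calc _ ≤ ∑ t ∈ Finset.range (n + 1), ρ ^ t * a t := by
            rw [Finset.sum_mul]
            refine Finset.sum_le_sum fun t ht => ?_
            rw [mul_comm]
            refine mul_le_mul_of_nonneg_right (hbern.trans ?_) (ha0 t)
            exact pow_le_pow_of_le_one (by linarith) hρ1.le
              (Nat.lt_succ_iff.1 (Finset.mem_range.1 ht))
        _ ≤ _ := (hsum ρ (by linarith) hρ1).sum_le_tsum _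
            fun t _ => mul_nonneg (pow_nonneg (by linarith) t) (ha0 t)
    rw [hlogρ] at hb
    rw [le_div_iff₀ hx1, div_mul_eq_mul_div, div_le_iff₀ hx0]
    have e2 : (κ * (1 + Real.log x / x) + C * (1 / x)) * x = κ * (x + Real.log x) + C := by
      field_simp
    rw [e2]
    linarith

/-! ### Expected number of half windings -/

open Classical in
theorem halfWindings_eq_sum (x : ℕ → ℤ × ℤ) (n : ℕ) : halfWindings x n =
    ∑ t ∈ Finset.range (n + 1), if ∃ s, IsHalfWinding x s t then 1 else 0 := by
  rw [halfWindings, ← Finset.card_filter, ← Set.ncard_coe_finset]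
  congr 1
  ext t
  simp

section Expectation

variable {Ω : Type*} [MeasurableSpace Ω] {μ : Measure Ω}
  {M : ℕ → Ω → ℤ × ℤ}

theorem measurableSet_exists_isHalfWinding (h : IsSimpleRandomWalk graphG1 (0, 0) μ M) (t : ℕ) :
    MeasurableSet {ω | ∃ s, IsHalfWinding (fun i => M i ω) s t} :=
  (dependsOnPrefix_exists_isHalfWinding t).measurableSet h.measurable

theorem measurable_halfWindings (h : IsSimpleRandomWalk graphG1 (0, 0) μ M) (n : ℕ) :
    Measurable fun ω => halfWindings (fun i => M i ω) n := by
  classical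
  simp_rw [halfWindings_eq_sum]
  exact Finset.measurable_sum _ fun t _ =>
    Measurable.ite (measurableSet_exists_isHalfWinding h t) measurable_const measurable_const

theorem halfWindings_le (x : ℕ → ℤ × ℤ) (n : ℕ) : halfWindings x n ≤ n + 1 := by
  classical
  rw [halfWindings_eq_sum, ← Finset.card_filter]
  exact (Finset.card_filter_le _ _).trans_eq (Finset.card_range _)

theorem integrable_halfWindings [IsProbabilityMeasure μ] (h : IsSimpleRandomWalk graphG1 (0, 0) μ M) (n : ℕ) :
    Integrable (fun ω => (halfWindings (fun i => M i ω) n : ℝ)) μ := by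
  refine Integrable.of_bound
    (measurable_from_top.comp (measurable_halfWindings h n)).aestronglyMeasurable (n + 1)
    (Eventually.of_forall fun ω => ?_)
  simp only [Real.norm_natCast]
  exact_mod_cast halfWindings_le _ n

theorem integrable_windings [IsProbabilityMeasure μ] (h : IsSimpleRandomWalk graphG1 (0, 0) μ M) (n : ℕ) :
    Integrable (fun ω => (windings (fun i => M i ω) n : ℝ)) μ := by
  refine Integrable.mono' (integrable_halfWindings h n)
    ((measurable_from_top (f := fun k : ℕ => ((k / 2 : ℕ) : ℝ))).comp
      (measurable_halfWindings h n)).aestronglyMeasurable (Eventually.of_forall fun ω => ?_)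
  simp only [windings, Real.norm_natCast]
  exact_mod_cast Nat.div_le_self _ _

theorem integral_halfWindings [IsProbabilityMeasure μ] (h : IsSimpleRandomWalk graphG1 (0, 0) μ M) (n : ℕ) :
    ∫ ω, (halfWindings (fun i => M i ω) n : ℝ) ∂μ =
      ∑ t ∈ Finset.range (n + 1), (halfWindingProb μ M t).toReal := by
  classical
  have e1 : ∀ ω, (halfWindings (fun i => M i ω) n : ℝ) = ∑ t ∈ Finset.range (n + 1),
      {ω | ∃ s, IsHalfWinding (fun i => M i ω) s t}.indicator (fun _ => (1 : ℝ)) ω := by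
    intro ω
    rw [halfWindings_eq_sum]
    push_cast
    refine Finset.sum_congr rfl fun t _ => ?_
    simp [Set.indicator_apply]
  simp_rw [e1]
  rw [integral_finsetSum _ fun t _ => (integrable_const _).indicator
    (measurableSet_exists_isHalfWinding h t)]
  refine Finset.sum_congr rfl fun t _ => ?_
  rw [integral_indicator_const _ (measurableSet_exists_isHalfWinding h t)]
  simp [halfWindingProb, Measure.real]

/-- The expectation is a partial sum of completion probabilities, whose coefficients lie in `[0,
1]`, so the Tauberian theorem applies with `κ = 1/π`. -/
theorem tendsto_integral_halfWindings_div_log [IsProbabilityMeasure μ] (h : IsSimpleRandomWalk graphG1 (0, 0) μ M) :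
    Tendsto (fun n : ℕ => (∫ ω, (halfWindings (fun i => M i ω) n : ℝ) ∂μ) / Real.log n) atTop
      (nhds (1 / Real.pi)) := by
  simp_rw [integral_halfWindings h]
  obtain ⟨C, hC⟩ := exists_genFun_halfWindingProb_bound h
  have hp : ∀ t, halfWindingProb μ M t ≤ 1 := fun t => prob_le_one
  refine tendsto_sum_div_log_of_abel (C := C) (fun t => ENNReal.toReal_nonneg)
    (fun t => ENNReal.toReal_mono ENNReal.one_ne_top (hp t)) fun ρ hρ0 hρ1 => ?_
  have h0 : (0 : ℝ) ≤ ρ := by linarith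
  have hr : (ENNReal.ofReal ρ).toReal = ρ := ENNReal.toReal_ofReal h0
  have := hC (ENNReal.ofReal ρ) (by rwa [ENNReal.ofReal_lt_one]) (by rwa [hr])
  rw [hr] at this
  convert this using 3
  rw [genFun, ENNReal.tsum_toReal_eq]
  · simp [hr]
  · exact fun t => ENNReal.mul_ne_top (ENNReal.pow_ne_top ENNReal.ofReal_ne_top)
      (ne_top_of_le_ne_top ENNReal.one_ne_top (hp t))

end Expectation

/-! ### From half windings to windings -/

theorem theorem4 {Ω : Type*} [MeasurableSpace Ω] (μ : Measure Ω) [IsProbabilityMeasure μ]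
    (M : ℕ → Ω → ℤ × ℤ) (hM : IsSimpleRandomWalk graphG1 (0, 0) μ M) :
    (fun n : ℕ => ∫ ω, (windings (fun i => M i ω) n : ℝ) ∂μ) ~[atTop]
      (fun n : ℕ => 1 / (2 * Real.pi) * Real.log (n : ℝ)) := by
  have hlog : Tendsto (fun n : ℕ => Real.log n) atTop atTop :=
    Real.tendsto_log_atTop.comp tendsto_natCast_atTop_atTop
  have hpos : ∀ᶠ n : ℕ in atTop, 0 < Real.log n := hlog.eventually_gt_atTop 0
  have hH := tendsto_integral_halfWindings_div_log hM
  -- Rounding down loses at most one half pointwise, which is negligible against `log n`.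
  have hbounds : ∀ n : ℕ, (∫ ω, (halfWindings (fun i => M i ω) n : ℝ) ∂μ) / 2 - 1 / 2 ≤
      ∫ ω, (windings (fun i => M i ω) n : ℝ) ∂μ ∧ ∫ ω, (windings (fun i => M i ω) n : ℝ) ∂μ ≤
      (∫ ω, (halfWindings (fun i => M i ω) n : ℝ) ∂μ) / 2 := by
    intro n
    have hi := integrable_halfWindings hM n
    have hw := integrable_windings hM n
    have hc : ∫ _, (1 / 2 : ℝ) ∂μ = 1 / 2 := by simp
    constructor
    · rw [← integral_div, ← hc, ← integral_sub (hi.div_const 2) (integrable_const _)]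
      refine integral_mono ((hi.div_const 2).sub (integrable_const _)) hw fun ω => ?_
      have : halfWindings (fun i => M i ω) n ≤ 2 * windings (fun i => M i ω) n + 1 := by
        unfold windings; omega
      have h2 : (halfWindings (fun i => M i ω) n : ℝ) ≤ 2 * windings (fun i => M i ω) n + 1 := by
        exact_mod_cast this
      simp only
      linarith
    · rw [← integral_div]
      refine integral_mono hw (hi.div_const 2) fun ω => ?_
      have : 2 * windings (fun i => M i ω) n ≤ halfWindings (fun i => M i ω) n := by
        unfold windings; omega
      have h2 : 2 * (windings (fun i => M i ω) n : ℝ) ≤ halfWindings (fun i => M i ω) n := by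
        exact_mod_cast this
      simp only
      linarith
  have hlim : Tendsto (fun n : ℕ => (∫ ω, (windings (fun i => M i ω) n : ℝ) ∂μ) / Real.log n)
      atTop (nhds (1 / (2 * Real.pi))) := by
    have e : 1 / (2 * Real.pi) = 1 / Real.pi / 2 := by field_simp
    rw [e]
    have hinv : Tendsto (fun n : ℕ => 1 / 2 * (Real.log n)⁻¹) atTop (nhds 0) := by
      have := hlog.inv_tendsto_atTop.const_mul (1 / 2 : ℝ)
      rwa [mul_zero] at this
    have hlow := (hH.div_const 2).sub hinv
    rw [sub_zero] at hlow
    refine tendsto_of_tendsto_of_tendsto_of_le_of_le' hlow (hH.div_const 2) ?_ ?_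
    · filter_upwards [hpos] with n hn
      rw [le_div_iff₀ hn]
      refine le_trans (le_of_eq ?_) (hbounds n).1
      field_simp
    · filter_upwards [hpos] with n hn
      rw [div_le_iff₀ hn]
      refine (hbounds n).2.trans (le_of_eq ?_)
      field_simp
  refine isEquivalent_of_tendsto_one ?_
  have h1 := hlim.div_const (1 / (2 * Real.pi))
  have hpi := Real.pi_pos
  rw [div_self (by positivity)] at h1
  refine h1.congr fun n => ?_
  simp only [Pi.div_apply]
  rw [div_div, mul_comm (Real.log _)]
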